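/- **Conventions.** Manifolds are real analytic, finite-dimensional, Hausdorff and second countable. Let $G$ be a Lie group (with unit $e$) acting from the left on a manifold $M$ such that $g\mapsto g\cdot x$ is analytic for each $x\in M$ and $x\mapsto g\cdot x$ is analytic for each $g\in G$. The action is *free* if all stabilizers $G_x$ are trivial, and *sated* if there are no $x\in M$, no two different points $y,z\in M\setminus\{x\}$ and no sequence $(g_n)$ in $G$ with $\lim_n g_n\cdot y=x=\lim_n g_n\cdot z$. An *interval* is a connected subset of $\mathbb R$ with non-empty interior. A curve $\gamma\colon D\to M$ on an interval $D$ is *analytic* (an *analytic immersion*, an *analytic embedding*) if it extends to an analytic map (an analytic immersion, an analytic immersion that is a homeomorphism onto its image) on an open interval containing $D$. An *analytic diffeomorphism* $\rho\colon D\to D'$ between intervals is a bijection which extends to an analytic diffeomorphism between open intervals. Put $G_\gamma=\{g\in G: g\cdot\gamma=\gamma\}$ and $[g]=g\cdot G_\gamma$. For curves $\gamma\colon D\to M$, $\gamma'\colon D'\to M$ write $\gamma\sim_\circ\gamma'$ if $\gamma(J)=\gamma'(J')$ for some open intervals $J\subseteq D$, $J'\subseteq D'$ on which $\gamma$, $\gamma'$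 are analytic embeddings. A *free segment* is an analytic immersion $\gamma\colon D\to M$ such that $g\cdot\gamma\sim_\circ\gamma$ implies $g\in G_\gamma$. An analytic curve is *free* if its restriction to some interval is a free segment. An interval $A\subseteq D$ is *free with respect to $\gamma$* if $\gamma|_A$ is a free segment, and *maximal* if it is free and not properly contained in another free interval. For curves $\gamma$ on $D$, $\gamma'$ on $D'$, write $\gamma\sim_{t,t'}\gamma'$ if $\gamma=\gamma'\circ\rho$ for an analytic diffeomorphism $\rho\colon D\to D'$ with $\rho(t)=t'$. For $\gamma$ on a compact interval $D=[a,b]$ write $\gamma\rightsquigarrow_+\gamma'$ (respectively $\gamma\rightsquigarrow_-\gamma'$) if * $D'=[a',b']$ and $\gamma\sim_{a,a'}\gamma'$ (respectively $\gamma\sim_{a,b'}\gamma'$), or * $D'=[a',b')$ with $b'\le\infty$, and $\gamma|_{[a,j)}\sim_{a,a'}\gamma'$ for some $a<j\le b$ (respectively $\gamma|_{(j,b]}\sim_{b,a'}\gamma'$ for some $a\le j<b$), or * $D'=(a',b']$ with $a'\ge-\infty$, and $\gamma|_{(j,b]}\sim_{b,b'}\gamma'$ for some $a\le j<b$ (respectively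 $\gamma|_{[a,j)}\sim_{a,b'}\gamma'$ for some $a<j\le b$). Write $\gamma\rightsquigarrow\gamma'$ if one of $\gamma\rightsquigarrow_\pm\gamma'$ holds. A *decomposition* of an open interval $I$ is a family $(a_n)_{n\in\mathfrak n}$ in $I$, strictly increasing in $n$, with $\mathfrak n=\{n\in\mathbb Z\setminus\{0\}: n_-\le n\le n_+\}$ for some $-\infty\le n_-<0<n_+\le\infty$ with $n_\pm \in (\mathbb Z\setminus\{0\})\cup\{\pm\infty\}$. Put $A_0=[a_{-1},a_1]$, $A_n=[a_{n-1},a_n]$ for $n_-<n\le-1$, $A_n=[a_n,a_{n+1}]$ for $1\le n<n_+$, and $A_{n_-}=I\cap(-\infty,a_{n_-}]$, $A_{n_+}=I\cap[a_{n_+},\infty)$ if $n_-$, $n_+$ are finite. For a free curve $\gamma\colon I\to M$ and a compact free interval $A$, an *$A$-decomposition* of $\gamma$ consists of a decomposition of $I$ with $A_0=A$ and classes $([g_n])_{n\in\mathfrak n}$ with $[g_{\pm1}]\ne[e]$ and $g_n\cdot\gamma|_A\rightsquigarrow\gamma|_{A_n}$ for all $n\in\mathfrak n$. A compact maximal interval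 $A$ is *positive* if it has an $A$-decomposition with $g_{1}\cdot\gamma|_A\rightsquigarrow_+\gamma|_{A_{1}}$ and $g_{-1}\cdot\gamma|_A\rightsquigarrow_+\gamma|_{A_{-1}}$, and $\gamma$ is *positive* if it admits a positive interval. **Statement.** Suppose that the action is sated and free. Let $I\subseteq\mathbb R$ be an open interval and let $\gamma\colon I\to M$ be an analytic immersion which is a free curve. Then exactly one of the following holds: $\gamma$ is a free segment, or $\gamma$ is positive. Moreover, for each $t\in I$ there is an open interval $J\subseteq I$ with $t\in J$ which is free with respect to $\gamma$ and such that $g\cdot\gamma(J)\cap\gamma(J)$ is finite for all $g\in G\setminus\{e\}$. -/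

import Mathlib

open Set Filter Topology
open scoped Manifold ContDiff

noncomputable section

namespace AnalyticCurves

/-- An interval: a connected subset of `ℝ` with non-empty interior. -/
def IsInterval (D : Set ℝ) : Prop :=
  IsConnected D ∧ (interior D).Nonempty

/-- An open interval (possibly unbounded). -/
def IsOpenInterval (I : Set ℝ) : Prop :=
  IsOpen I ∧ IsInterval I

/-! ### Analytic diffeomorphisms between intervals -/

/-- `ρ` is an analytic diffeomorphism from the open set `U` onto the open set `V`: a bijection
which is analytic together with its inverse `σ`. -/
def IsOpenAnalyticDiffeo (ρ : ℝ → ℝ) (U V : Set ℝ) : Prop :=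
  AnalyticOnNhd ℝ ρ U ∧ MapsTo ρ U V ∧
    ∃ σ : ℝ → ℝ, AnalyticOnNhd ℝ σ V ∧ MapsTo σ V U ∧ InvOn σ ρ U V

/-- `ρ : D → D'` is an analytic diffeomorphism between intervals: it maps `D` bijectively onto `D'`
and is the restriction of an analytic diffeomorphism between open intervals. Only the values of
`ρ` on `D` matter. -/
def IsAnalyticDiffeo (ρ : ℝ → ℝ) (D D' : Set ℝ) : Prop :=
  IsInterval D ∧ IsInterval D' ∧ BijOn ρ D D' ∧
    ∃ (U V : Set ℝ) (ρ' : ℝ → ℝ), IsOpenInterval U ∧ IsOpenInterval V ∧ D ⊆ U ∧ D' ⊆ V ∧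
      IsOpenAnalyticDiffeo ρ' U V ∧ EqOn ρ' ρ D

/-! ### Curves

A curve `γ : D → M` is represented by a map `γ : ℝ → M` together with its domain `D`; the values
of `γ` outside of `D` never matter. Accordingly, the restriction `γ|_A` is `γ` with domain `A`, and
the translate `g · γ` is `fun t ↦ g • γ t`. The model space of the manifold `M` is `E`. -/

section Curves

variable (E : Type*) [NormedAddCommGroup E] [NormedSpace ℝ E]
variable {M : Type*} [TopologicalSpace M] [ChartedSpace E M]

/-- `γ : D → M` is an analytic curve: it extends to an analytic map on an open interval. -/
def IsAnalyticCurve (γ : ℝ → M) (D : Set ℝ) : Prop :=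
  IsInterval D ∧ ∃ (U : Set ℝ) (δ : ℝ → M), IsOpenInterval U ∧ D ⊆ U ∧ EqOn δ γ D ∧
    ContMDiffOn 𝓘(ℝ, ℝ) 𝓘(ℝ, E) ω δ U

/-- The map `δ`, on the open set `U`, is analytic with injective differentials. -/
def IsOpenAnalyticImmersion (δ : ℝ → M) (U : Set ℝ) : Prop :=
  ContMDiffOn 𝓘(ℝ, ℝ) 𝓘(ℝ, E) ω δ U ∧
    ∀ t ∈ U, Function.Injective (mfderiv 𝓘(ℝ, ℝ) 𝓘(ℝ, E) δ t)

/-- `γ : D → M` is an analytic immersion: it extends to an analytic immersion of an open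
interval. -/
def IsAnalyticImmersion (γ : ℝ → M) (D : Set ℝ) : Prop :=
  IsInterval D ∧ ∃ (U : Set ℝ) (δ : ℝ → M), IsOpenInterval U ∧ D ⊆ U ∧ EqOn δ γ D ∧
    IsOpenAnalyticImmersion E δ U

/-- `γ : D → M` is an analytic embedding: it extends to an analytic immersion of an open interval
which is a homeomorphism onto its image. -/
def IsAnalyticEmbedding (γ : ℝ → M) (D : Set ℝ) : Prop :=
  IsInterval D ∧ ∃ (U : Set ℝ) (δ : ℝ → M), IsOpenInterval U ∧ D ⊆ U ∧ EqOn δ γ D ∧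
    IsOpenAnalyticImmersion E δ U ∧ IsEmbedding (U.domRestrict δ)

/-- The overlap relation `γ ∼∘ γ'` of the curves `γ : D → M` and `γ' : D' → M`: they share a
segment, i.e. `γ(J) = γ'(J')` for open intervals `J ⊆ D`, `J' ⊆ D'` on which `γ` and `γ'` are
embeddings, respectively. -/
def Overlap (γ : ℝ → M) (D : Set ℝ) (γ' : ℝ → M) (D' : Set ℝ) : Prop :=
  ∃ J J' : Set ℝ, IsOpenInterval J ∧ IsOpenInterval J' ∧ J ⊆ D ∧ J' ⊆ D' ∧
    IsAnalyticEmbedding E γ J ∧ IsAnalyticEmbedding E γ' J' ∧ γ '' J = γ' '' J'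

end Curves

section Reparametrization

variable {M : Type*}

/-- `γ : D → M` and `γ' : D' → M` are related by an analytic diffeomorphism `ρ : D → D'` with
`ρ t = t'`. -/
def ReparamAt (γ : ℝ → M) (D : Set ℝ) (t : ℝ) (γ' : ℝ → M) (D' : Set ℝ) (t' : ℝ) : Prop :=
  t ∈ D ∧ t' ∈ D' ∧ ∃ ρ : ℝ → ℝ, IsAnalyticDiffeo ρ D D' ∧ ρ t = t' ∧ ∀ s ∈ D, γ s = γ' (ρ s)

/-- `D` is of the form `[a, b)` with `a < b ≤ ∞`. -/
def IsClosedOpen (D : Set ℝ) (a : ℝ) : Prop :=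
  (∃ b, a < b ∧ D = Ico a b) ∨ D = Ici a

/-- `D` is of the form `(a, b]` with `-∞ ≤ a < b`. -/
def IsOpenClosed (D : Set ℝ) (b : ℝ) : Prop :=
  (∃ a, a < b ∧ D = Ioc a b) ∨ D = Iic b

/-- The relation `γ ⇝₊ γ'` for a curve `γ` on the compact interval `[a, b]` and a curve `γ'` on
an interval `D'` which is compact or half-open. -/
def ReparamPos (γ : ℝ → M) (a b : ℝ) (γ' : ℝ → M) (D' : Set ℝ) : Prop :=
  (∃ a' b', a' < b' ∧ D' = Icc a' b' ∧ ReparamAt γ (Icc a b) a γ' D' a') ∨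
  (∃ a' j, IsClosedOpen D' a' ∧ a < j ∧ j ≤ b ∧ ReparamAt γ (Ico a j) a γ' D' a') ∨
  (∃ b' j, IsOpenClosed D' b' ∧ a ≤ j ∧ j < b ∧ ReparamAt γ (Ioc j b) b γ' D' b')

/-- The relation `γ ⇝₋ γ'`, the orientation reversing counterpart of `ReparamPos`. -/
def ReparamNeg (γ : ℝ → M) (a b : ℝ) (γ' : ℝ → M) (D' : Set ℝ) : Prop :=
  (∃ a' b', a' < b' ∧ D' = Icc a' b' ∧ ReparamAt γ (Icc a b) a γ' D' b') ∨
  (∃ a' j, IsClosedOpen D' a' ∧ a ≤ j ∧ j < b ∧ ReparamAt γ (Ioc j b) b γ' D' a') ∨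
  (∃ b' j, IsOpenClosed D' b' ∧ a < j ∧ j ≤ b ∧ ReparamAt γ (Ico a j) a γ' D' b')

/-- The relation `γ ⇝ γ'`. -/
def Reparam (γ : ℝ → M) (a b : ℝ) (γ' : ℝ → M) (D' : Set ℝ) : Prop :=
  ReparamPos γ a b γ' D' ∨ ReparamNeg γ a b γ' D'

end Reparametrization

/-- A decomposition of the interval `I`: points `a n` of the interior of `I`, strictly increasing
in `n`, where `n` runs through the non-zero integers with `lo ≤ n ≤ hi` for some
`-∞ ≤ lo < 0 < hi ≤ ∞`. The values of `a` at other integers never matter. -/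
structure Decomposition (I : Set ℝ) where
  lo : WithBot ℤ
  hi : WithTop ℤ
  lo_neg : lo < ((0 : ℤ) : WithBot ℤ)
  hi_pos : ((0 : ℤ) : WithTop ℤ) < hi
  a : ℤ → ℝ
  a_mem : ∀ n : ℤ, n ≠ 0 → lo ≤ (n : WithBot ℤ) → (n : WithTop ℤ) ≤ hi → a n ∈ interior I
  a_lt : ∀ m n : ℤ, m ≠ 0 → n ≠ 0 → lo ≤ (m : WithBot ℤ) → (n : WithTop ℤ) ≤ hi →
    m < n → a m < a n

namespace Decomposition

variable {I : Set ℝ}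

/-- The index set of a decomposition. -/
def index (d : Decomposition I) : Set ℤ :=
  {n | n ≠ 0 ∧ d.lo ≤ (n : WithBot ℤ) ∧ (n : WithTop ℤ) ≤ d.hi}

open Classical in
/-- The intervals `A_n` of a decomposition, for `n` in the index set or `n = 0`. -/
def piece (d : Decomposition I) (n : ℤ) : Set ℝ :=
  if n = 0 then Icc (d.a (-1)) (d.a 1)
  else if n < 0 then
    if d.lo = (n : WithBot ℤ) then I ∩ Iic (d.a n) else Icc (d.a (n - 1)) (d.a n)
  else
    if d.hi = (n : WithTop ℤ) then I ∩ Ici (d.a n) else Icc (d.a n) (d.a (n + 1))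

end Decomposition

/-! ### Group actions and free curves -/

section Action

variable (E : Type*) [NormedAddCommGroup E] [NormedSpace ℝ E]
variable (G : Type*) [Group G]
variable {M : Type*} [TopologicalSpace M] [MulAction G M]

/-- The point `x` is sated: no sequence of group elements moves two different points, both
different from `x`, simultaneously to `x` in the limit. -/
def IsSatedAt (x : M) : Prop :=
  ¬ ∃ y z : M, y ≠ z ∧ y ≠ x ∧ z ≠ x ∧ ∃ g : ℕ → G,
    Tendsto (fun n => g n • y) atTop (𝓝 x) ∧ Tendsto (fun n => g n • z) atTop (𝓝 x)

/-- The stabilizer `G_γ` of the curve `γ : D → M`. -/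
def curveStabilizer (γ : ℝ → M) (D : Set ℝ) : Subgroup G :=
  ⨅ t ∈ D, MulAction.stabilizer G (γ t)

variable [ChartedSpace E M]

/-- `γ : D → M` is a free segment: an analytic immersion such that each `g` for which `g · γ`
overlaps `γ` fixes `γ`. -/
def IsFreeSegment (γ : ℝ → M) (D : Set ℝ) : Prop :=
  IsAnalyticImmersion E γ D ∧
    ∀ g : G, Overlap E (fun t => g • γ t) D γ D → ∀ t ∈ D, g • γ t = γ t

/-- `γ : D → M` is a free curve: an analytic curve which restricts to a free segment on some
interval. -/
def IsFreeCurve (γ : ℝ → M) (D : Set ℝ) : Prop :=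
  IsAnalyticCurve E γ D ∧ ∃ D' : Set ℝ, IsInterval D' ∧ D' ⊆ D ∧ IsFreeSegment E G γ D'

/-- The interval `A ⊆ D` is free with respect to `γ : D → M`. -/
def IsFreeInterval (γ : ℝ → M) (D A : Set ℝ) : Prop :=
  IsInterval A ∧ A ⊆ D ∧ IsFreeSegment E G γ A

/-- The interval `A ⊆ D` is maximal among the free intervals of `γ : D → M`. -/
def IsMaximalInterval (γ : ℝ → M) (D A : Set ℝ) : Prop :=
  IsFreeInterval E G γ D A ∧ ∀ A' : Set ℝ, IsFreeInterval E G γ D A' → ¬ A ⊂ A'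

/-- For `A = [p, q]` free, `(d, g)` is an `A`-decomposition of `γ : I → M`: `A` is the interval
`A_0` of `d`, the classes of `g 1` and `g (-1)` modulo `G_γ` are non-trivial, and
`g n · γ|_A ⇝ γ|_{A_n}` for every index `n`. Classes `[g n] = g n · G_γ` enter through
representatives, on which none of these conditions depends. -/
def IsDecompositionOf (γ : ℝ → M) (I : Set ℝ) (p q : ℝ) (d : Decomposition I) (g : ℤ → G) :
    Prop :=
  p < q ∧ IsFreeInterval E G γ I (Icc p q) ∧ d.piece 0 = Icc p q ∧
    g 1 ∉ curveStabilizer G γ I ∧ g (-1) ∉ curveStabilizer G γ I ∧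
    ∀ n ∈ d.index, Reparam (fun t => g n • γ t) p q γ (d.piece n)

/-- The compact maximal interval `[p, q]` is positive: in an associated decomposition of `γ`, the
neighbouring intervals on both sides are related to it by orientation preserving
reparametrizations. -/
def IsPositiveInterval (γ : ℝ → M) (I : Set ℝ) (p q : ℝ) : Prop :=
  IsMaximalInterval E G γ I (Icc p q) ∧
    ∃ (d : Decomposition I) (g : ℤ → G), IsDecompositionOf E G γ I p q d g ∧
      ReparamPos (fun t => g 1 • γ t) p q γ (d.piece 1) ∧
      ReparamPos (fun t => g (-1) • γ t) p q γ (d.piece (-1))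

/-- `γ : I → M` is positive: it admits a positive interval. -/
def IsPositiveCurve (γ : ℝ → M) (I : Set ℝ) : Prop :=
  ∃ p q : ℝ, IsPositiveInterval E G γ I p q

end Action

end AnalyticCurves

end

namespace AnalyticCurves

set_option linter.unusedSectionVars false

/-! ### Germs of immersed curves and their reparametrizations -/

section Germs

variable (E : Type*) [NormedAddCommGroup E] [NormedSpace ℝ E]
variable {M : Type*} [TopologicalSpace M] [ChartedSpace E M]

/-- The germ of `γ` at `t` is an analytic immersion, expressed in the preferred chart at `γ t`. -/
structure ImmersedAt (γ : ℝ → M) (t : ℝ) : Prop where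
  continuousAt : ContinuousAt γ t
  analyticAt : AnalyticAt ℝ (fun s => extChartAt 𝓘(ℝ, E) (γ t) (γ s)) t
  deriv_ne_zero : deriv (fun s => extChartAt 𝓘(ℝ, E) (γ t) (γ s)) t ≠ 0

variable {E}

theorem ImmersedAt.of_contMDiffAt [CompleteSpace E] {γ : ℝ → M} {t : ℝ}
    (h : ContMDiffAt 𝓘(ℝ, ℝ) 𝓘(ℝ, E) ω γ t)
    (h' : Function.Injective (mfderiv 𝓘(ℝ, ℝ) 𝓘(ℝ, E) γ t)) : ImmersedAt E γ t := by
  have h1 := (contMDiffAt_iff_target.1 h)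
  have h2 : AnalyticAt ℝ (fun s => extChartAt 𝓘(ℝ, E) (γ t) (γ s)) t := by
    have := (contMDiffAt_iff_contDiffAt.1 h1.2).contDiffWithinAt (s := univ)
    rw [contDiffWithinAt_omega_iff_analyticWithinAt, analyticWithinAt_univ] at this
    exact this
  refine ⟨h1.1, h2, fun h0 => ?_⟩
  have h3 : mfderiv 𝓘(ℝ, ℝ) 𝓘(ℝ, E) γ t
      = fderiv ℝ (fun s => extChartAt 𝓘(ℝ, E) (γ t) (γ s)) t := by
    rw [(h.mdifferentiableAt (by simp)).mfderiv]
    simp [writtenInExtChartAt, Function.comp_def]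
    rfl
  have h4 : fderiv ℝ (fun s => extChartAt 𝓘(ℝ, E) (γ t) (γ s)) t = 0 := by
    apply ContinuousLinearMap.ext_ring
    exact h0
  rw [h4] at h3
  rw [h3] at h'
  exact one_ne_zero (α := ℝ) (h' (a₁ := (1 : ℝ)) (a₂ := (0 : ℝ)) rfl)

/-- A linear functional that does not vanish on the velocity turns the curve in the chart into a
real function with nonzero derivative; its analytic local inverse, composed with the functional,
recovers the parameter. -/
theorem ImmersedAt.exists_retraction {γ : ℝ → M} {t : ℝ} (h : ImmersedAt E γ t) :
    ∃ r : E → ℝ, AnalyticAt ℝ r (extChartAt 𝓘(ℝ, E) (γ t) (γ t)) ∧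
      ∀ᶠ s in 𝓝 t, r (extChartAt 𝓘(ℝ, E) (γ t) (γ s)) = s := by
  obtain ⟨l, hl⟩ := exists_dual_vector ℝ _ (norm_ne_zero_iff.2 h.deriv_ne_zero)
  set c := fun s => extChartAt 𝓘(ℝ, E) (γ t) (γ s) with hc
  have ha : AnalyticAt ℝ (fun s => l (c s)) t :=
    (l.analyticAt _).fun_comp h.analyticAt
  have hd : deriv (fun s => l (c s)) t ≠ 0 := by
    have := (l.hasFDerivAt.comp_hasDerivAt t h.analyticAt.differentiableAt.hasDerivAt).deriv
    have h2 : deriv (fun s => l (c s)) t = l (deriv c t) := this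
    rw [h2, hl.2]
    exact norm_ne_zero_iff.2 h.deriv_ne_zero
  refine ⟨fun v => ha.hasStrictDerivAt.localInverse _ _ _ hd (l v), ?_, ?_⟩
  · exact AnalyticAt.fun_comp (ha.analyticAt_localInverse hd) (l.analyticAt _)
  · exact ha.hasStrictDerivAt.eventually_left_inverse hd

/-- An immersed curve is locally injective. -/
theorem ImmersedAt.eventually_injective {γ : ℝ → M} {t : ℝ} (h : ImmersedAt E γ t) :
    ∀ᶠ p : ℝ × ℝ in 𝓝 (t, t), γ p.1 = γ p.2 → p.1 = p.2 := by
  obtain ⟨r, -, hr⟩ := h.exists_retraction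
  rw [nhds_prod_eq]
  filter_upwards [hr.prod_mk hr] with p hp he
  rw [← hp.1, ← hp.2, he]

theorem ImmersedAt.eventually_eq {γ : ℝ → M} {t : ℝ} (h : ImmersedAt E γ t) {ι : Type*}
    {l : Filter ι} {σ τ : ι → ℝ} (hσ : Tendsto σ l (𝓝 t)) (hτ : Tendsto τ l (𝓝 t))
    (he : ∀ᶠ i in l, γ (σ i) = γ (τ i)) : ∀ᶠ i in l, σ i = τ i := by
  filter_upwards [(hσ.prodMk_nhds hτ).eventually h.eventually_injective, he] with i h1 h2
  exact h1 h2

/-- Two immersed curves with accumulating intersections are locally reparametrizations of each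
other. -/
theorem ImmersedAt.exists_reparam [T2Space M] {γ₁ γ₂ : ℝ → M} {a b : ℝ} (h₁ : ImmersedAt E γ₁ a)
    (h₂ : ImmersedAt E γ₂ b) {ι : Type*} {l : Filter ι} [l.NeBot] {σ τ : ι → ℝ}
    (hσ : Tendsto σ l (𝓝[≠] a)) (hτ : Tendsto τ l (𝓝 b))
    (he : ∀ᶠ i in l, γ₁ (σ i) = γ₂ (τ i)) :
    ∃ ρ : ℝ → ℝ, AnalyticAt ℝ ρ a ∧ ρ a = b ∧ ∀ᶠ s in 𝓝 a, γ₁ s = γ₂ (ρ s) := by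
  have hσ' : Tendsto σ l (𝓝 a) := hσ.mono_right nhdsWithin_le_nhds
  have hab : γ₁ a = γ₂ b := by
    refine tendsto_nhds_unique_of_eventuallyEq (h₁.continuousAt.tendsto.comp hσ')
      (h₂.continuousAt.tendsto.comp hτ) he
  obtain ⟨r, hra, hr⟩ := h₂.exists_retraction
  have hA1 := h₁.analyticAt
  rw [hab] at hA1
  have hra' := hra
  rw [← hab] at hra'
  set φ := extChartAt 𝓘(ℝ, E) (γ₂ b) with hφ
  have hρ : AnalyticAt ℝ (fun s => r (φ (γ₁ s))) a := by
    refine AnalyticAt.fun_comp (f := fun s => φ (γ₁ s)) ?_ hA1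
    simpa [hab] using hra
  have hρa : r (φ (γ₁ a)) = b := by rw [hab]; exact hr.self_of_nhds
  -- The only candidate is the retraction of `γ₂` applied to `γ₁`. At an intersection it sends `σ i`
  -- to `τ i`, so `γ₁` and `γ₂ ∘ ρ` agree there, and the identity theorem in the chart extends this
  -- to a neighbourhood.
  refine ⟨fun s => r (φ (γ₁ s)), hρ, hρa, ?_⟩
  have hA2 : AnalyticAt ℝ (fun s => φ (γ₂ (r (φ (γ₁ s))))) a := by
    refine AnalyticAt.fun_comp (g := fun s => φ (γ₂ s)) (f := fun s => r (φ (γ₁ s))) ?_ hρ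
    rw [hρa]
    exact h₂.analyticAt
  have hfreq : ∃ᶠ s in 𝓝[≠] a, φ (γ₁ s) = φ (γ₂ (r (φ (γ₁ s)))) := by
    refine hσ.frequently (Eventually.frequently ?_)
    filter_upwards [he, hτ.eventually hr] with i h1 h2
    rw [h1, h2]
  have hev := (hA1.frequently_eq_iff_eventually_eq hA2).1 hfreq
  have hs1 : ∀ᶠ s in 𝓝 a, γ₁ s ∈ φ.source := by
    refine h₁.continuousAt.eventually ?_
    rw [hab]
    exact extChartAt_source_mem_nhds _
  have hs2 : ∀ᶠ s in 𝓝 a, γ₂ (r (φ (γ₁ s))) ∈ φ.source := by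
    have : Tendsto (fun s => r (φ (γ₁ s))) (𝓝 a) (𝓝 b) := by
      have := hρ.continuousAt.tendsto
      rwa [hρa] at this
    exact (h₂.continuousAt.tendsto.comp this).eventually (extChartAt_source_mem_nhds _)
  filter_upwards [hev, hs1, hs2] with s h1 h2 h3
  exact φ.injOn h2 h3 h1

/-- Reparametrizations between immersed curves have non-vanishing derivative. -/
theorem ImmersedAt.deriv_reparam_ne_zero {γ₁ γ₂ : ℝ → M} {a : ℝ} {ρ : ℝ → ℝ}
    (h₁ : ImmersedAt E γ₁ a) (h₂ : ImmersedAt E γ₂ (ρ a)) (hρ : AnalyticAt ℝ ρ a)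
    (he : ∀ᶠ s in 𝓝 a, γ₁ s = γ₂ (ρ s)) : deriv ρ a ≠ 0 := by
  intro h0
  apply h₁.deriv_ne_zero
  rw [he.self_of_nhds]
  have : (fun s => extChartAt 𝓘(ℝ, E) (γ₂ (ρ a)) (γ₁ s)) =ᶠ[𝓝 a]
      (fun s => extChartAt 𝓘(ℝ, E) (γ₂ (ρ a)) (γ₂ s)) ∘ ρ := by
    filter_upwards [he] with s hs
    simp [hs]
  rw [this.deriv_eq]
  have h3 := (h₂.analyticAt.differentiableAt.hasDerivAt.scomp a hρ.differentiableAt.hasDerivAt)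
  rw [h3.deriv, h0, zero_smul]

end Germs

/-! ### Germ relations and their maximal analytic continuation -/

section Shifts

variable (E : Type*) [NormedAddCommGroup E] [NormedSpace ℝ E]
variable (G : Type*) [Group G]
variable {M : Type*} [TopologicalSpace M] [ChartedSpace E M] [MulAction G M]

/-- All translates of `γ` are immersed at all points of the open interval `I`. -/
structure IsImmersedOn (γ : ℝ → M) (I : Set ℝ) : Prop where
  isOpen : IsOpen I
  ordConnected : I.OrdConnected
  smul_immersedAt : ∀ (h : G), ∀ t ∈ I, ImmersedAt E (fun s => h • γ s) t

variable {G} in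
/-- The germ of `h • γ` at `s` is a reparametrization of the germ of `γ` at `t`. -/
def GermRel (γ : ℝ → M) (I : Set ℝ) (h : G) (s t : ℝ) : Prop :=
  s ∈ I ∧ t ∈ I ∧ ∃ ρ : ℝ → ℝ, AnalyticAt ℝ ρ s ∧ ρ s = t ∧ ∀ᶠ x in 𝓝 s, h • γ x = γ (ρ x)

variable {E G} {γ : ℝ → M} {I : Set ℝ}

theorem IsImmersedOn.immersedAt (H : IsImmersedOn E G γ I) {t : ℝ} (ht : t ∈ I) :
    ImmersedAt E γ t := by
  simpa using H.smul_immersedAt 1 t ht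

theorem GermRel.smul_eq {h : G} {s t : ℝ} (hr : GermRel γ I h s t) : h • γ s = γ t := by
  obtain ⟨-, -, ρ, -, h1, h2⟩ := hr
  rw [h2.self_of_nhds, h1]

theorem IsImmersedOn.germRel_of_tendsto [T2Space M] (H : IsImmersedOn E G γ I) {h : G} {a b : ℝ}
    (ha : a ∈ I) (hb : b ∈ I) {ι : Type*} {l : Filter ι} [l.NeBot] {σ τ : ι → ℝ}
    (hσ : Tendsto σ l (𝓝[≠] a)) (hτ : Tendsto τ l (𝓝 b))
    (he : ∀ᶠ i in l, h • γ (σ i) = γ (τ i)) : GermRel γ I h a b :=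
  ⟨ha, hb, (H.smul_immersedAt h a ha).exists_reparam (H.immersedAt hb) hσ hτ he⟩

/-- The intersections at the parameter pairs `(ρ x, x)`, with `x → s`, accumulate at `(t, s)`, so
the accumulation criterion with the roles exchanged produces the inverse germ. Local injectivity
ensures `ρ x ≠ t` for `x ≠ s`. -/
theorem GermRel.symm [T2Space M] (H : IsImmersedOn E G γ I) {h : G} {s t : ℝ}
    (hr : GermRel γ I h s t) : GermRel γ I h⁻¹ t s := by
  obtain ⟨hs, ht, ρ, hρ, h1, h2⟩ := hr
  have hρt : Tendsto ρ (𝓝 s) (𝓝 t) := h1 ▸ hρ.continuousAt.tendsto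
  refine H.germRel_of_tendsto (l := 𝓝[≠] s) (σ := ρ) (τ := id) ht hs ?_
    (tendsto_id.mono_left nhdsWithin_le_nhds) ?_
  · refine tendsto_nhdsWithin_iff.2 ⟨hρt.mono_left nhdsWithin_le_nhds, ?_⟩
    have hinj := (tendsto_id.prodMk_nhds (tendsto_const_nhds (x := s))).eventually
      (H.smul_immersedAt h s hs).eventually_injective
    filter_upwards [nhdsWithin_le_nhds hinj, nhdsWithin_le_nhds h2, self_mem_nhdsWithin]
      with x hx1 hx2 hx3 hx4
    refine hx3 (hx1 ?_)
    change h • γ x = h • γ s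
    rw [hx2, hx4, h2.self_of_nhds, h1]
  · filter_upwards [nhdsWithin_le_nhds h2] with x hx
    rw [← hx, inv_smul_smul]
    rfl

theorem GermRel.trans {h k : G} {s t u : ℝ} (hr : GermRel γ I h s t) (hk : GermRel γ I k t u) :
    GermRel γ I (k * h) s u := by
  obtain ⟨hs, -, ρ, hρ, h1, h2⟩ := hr
  obtain ⟨-, hu, τ, hτ, h3, h4⟩ := hk
  have hρt : Tendsto ρ (𝓝 s) (𝓝 t) := h1 ▸ hρ.continuousAt.tendsto
  refine ⟨hs, hu, fun x => τ (ρ x), ?_, by simp only [h1, h3], ?_⟩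
  · exact AnalyticAt.fun_comp (by rwa [h1]) hρ
  · filter_upwards [h2, hρt.eventually h4] with x hx1 hx2
    rw [mul_smul, hx1, hx2]

theorem germRel_of_analyticOnNhd {h : G} {J : Set ℝ} {f : ℝ → ℝ} (hJ : IsOpen J)
    (hJI : J ⊆ I) (hf : AnalyticOnNhd ℝ f J) (hfI : MapsTo f J I)
    (he : ∀ z ∈ J, h • γ z = γ (f z)) {z : ℝ} (hz : z ∈ J) : GermRel γ I h z (f z) :=
  ⟨hJI hz, hfI hz, f, hf z hz, rfl, Filter.mem_of_superset (hJ.mem_nhds hz) he⟩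

/-- `f`, on the open interval `J` containing `x`, reparametrizes `h • γ` to `γ` and maps
`x` to `y`. -/
structure IsExtension (γ : ℝ → M) (I : Set ℝ) (h : G) (x y : ℝ) (J : Set ℝ) (f : ℝ → ℝ) :
    Prop where
  isOpen : IsOpen J
  ordConnected : J.OrdConnected
  mem : x ∈ J
  subset : J ⊆ I
  mapsTo : MapsTo f J I
  analytic : AnalyticOnNhd ℝ f J
  apply_eq : f x = y
  smul_eq : ∀ z ∈ J, h • γ z = γ (f z)

theorem GermRel.exists_extension (H : IsImmersedOn E G γ I) {h : G} {x y : ℝ}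
    (hr : GermRel γ I h x y) : ∃ J f, IsExtension γ I h x y J f := by
  obtain ⟨hx, hy, ρ, hρ, h1, h2⟩ := hr
  have h3 : ∀ᶠ z in 𝓝 x, ρ z ∈ I :=
    hρ.continuousAt.eventually (by rw [h1]; exact H.isOpen.mem_nhds hy)
  obtain ⟨ε, hε, hball⟩ := Metric.eventually_nhds_iff_ball.1
    (((H.isOpen.eventually_mem hx).and h3).and (hρ.eventually_analyticAt.and h2))
  rw [Real.ball_eq_Ioo] at hball
  exact ⟨Ioo (x - ε) (x + ε), ρ, isOpen_Ioo, ordConnected_Ioo, by constructor <;> linarith,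
    fun z hz => (hball z hz).1.1, fun z hz => (hball z hz).1.2, fun z hz => (hball z hz).2.1, h1,
    fun z hz => (hball z hz).2.2⟩

/-- Near `x` both maps are determined by local injectivity of `γ` at `y`; the identity theorem on
the interval `J ∩ J'` does the rest. This is what allows all extensions to be glued into a maximal
one. -/
theorem IsExtension.eqOn (H : IsImmersedOn E G γ I) {h : G} {x y : ℝ} {J J' : Set ℝ}
    {f f' : ℝ → ℝ} (hf : IsExtension γ I h x y J f) (hf' : IsExtension γ I h x y J' f') :
    EqOn f f' (J ∩ J') := by
  have hy : y ∈ I := hf.apply_eq ▸ hf.mapsTo hf.mem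
  refine (hf.analytic.mono inter_subset_left).eqOn_of_preconnected_of_eventuallyEq
    (hf'.analytic.mono inter_subset_right)
    (hf.ordConnected.inter hf'.ordConnected).isPreconnected ⟨hf.mem, hf'.mem⟩ ?_
  refine (H.immersedAt hy).eventually_eq ?_ ?_ ?_
  · simpa [hf.apply_eq] using (hf.analytic x hf.mem).continuousAt.tendsto
  · simpa [hf'.apply_eq] using (hf'.analytic x hf'.mem).continuousAt.tendsto
  · filter_upwards [hf.isOpen.mem_nhds hf.mem, hf'.isOpen.mem_nhds hf'.mem] with z h1 h2
    rw [← hf.smul_eq z h1, hf'.smul_eq z h2]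

theorem GermRel.exists_maximal_extension (H : IsImmersedOn E G γ I) {h : G} {x y : ℝ}
    (hr : GermRel γ I h x y) : ∃ J f, IsExtension γ I h x y J f ∧
      ∀ J' f', IsExtension γ I h x y J' f' → J' ⊆ J := by
  obtain ⟨J₀, f₀, h₀⟩ := hr.exists_extension H
  set S : Set (Set ℝ) := {J | ∃ f, IsExtension γ I h x y J f} with hS
  have hmem : ∀ z ∈ ⋃₀ S, ∃ J f, IsExtension γ I h x y J f ∧ z ∈ J := by
    rintro z ⟨J, ⟨f, hf⟩, hz⟩
    exact ⟨J, f, hf, hz⟩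
  choose! 𝒥 𝒻 hext hz using hmem
  have hfeq : ∀ J f, IsExtension γ I h x y J f → EqOn (fun z => 𝒻 z z) f J := by
    intro J f hf z hzJ
    have hzS : z ∈ ⋃₀ S := ⟨J, ⟨f, hf⟩, hzJ⟩
    exact (hext z hzS).eqOn H hf ⟨hz z hzS, hzJ⟩
  refine ⟨⋃₀ S, fun z => 𝒻 z z, ⟨?_, ?_, ⟨J₀, ⟨f₀, h₀⟩, h₀.mem⟩, ?_, ?_, ?_, ?_, ?_⟩, ?_⟩
  · exact isOpen_sUnion fun J ⟨f, hf⟩ => hf.isOpen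
  · refine (isPreconnected_sUnion x S (fun J ⟨f, hf⟩ => hf.mem) fun J ⟨f, hf⟩ => ?_).ordConnected
    exact hf.ordConnected.isPreconnected
  · exact sUnion_subset fun J ⟨f, hf⟩ => hf.subset
  · rintro z ⟨J, ⟨f, hf⟩, hzJ⟩
    rw [hfeq J f hf hzJ]
    exact hf.mapsTo hzJ
  · rintro z ⟨J, ⟨f, hf⟩, hzJ⟩
    refine (hf.analytic z hzJ).congr ?_
    filter_upwards [hf.isOpen.mem_nhds hzJ] with w hw using (hfeq J f hf hw).symm
  · exact (hfeq J₀ f₀ h₀ h₀.mem).trans h₀.apply_eq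
  · rintro z ⟨J, ⟨f, hf⟩, hzJ⟩
    exact (hf.smul_eq z hzJ).trans (congrArg γ (hfeq J f hf hzJ).symm)
  · exact fun J' f' hf' => subset_sUnion_of_mem ⟨f', hf'⟩

/-- A maximal reparametrization has no limit in `I` at a boundary point of its domain in `I`. -/
theorem IsExtension.not_tendsto_of_maximal [T2Space M] (H : IsImmersedOn E G γ I) {h : G}
    {x y : ℝ} {J : Set ℝ} {f : ℝ → ℝ} (hf : IsExtension γ I h x y J f)
    (hmax : ∀ J' f', IsExtension γ I h x y J' f' → J' ⊆ J) {a b : ℝ} (ha : a ∈ I) (haJ : a ∉ J)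
    [(𝓝[J] a).NeBot] (hb : b ∈ I) : ¬ Tendsto f (𝓝[J] a) (𝓝 b) := by
  classical
  intro ht
  have hle : 𝓝[J] a ≤ 𝓝[≠] a := nhdsWithin_mono a fun z hz => by
    rintro rfl
    exact haJ hz
  -- A limit in `I` makes the intersections accumulate at `(a, b)`, hence gives a germ `ρ` there. It
  -- agrees with `f` on `J` near `a`, so gluing the two extends `f` past `a`.
  have hr : GermRel γ I h a b := H.germRel_of_tendsto ha hb (l := 𝓝[J] a) (σ := id) (τ := f)
    hle ht (by filter_upwards [self_mem_nhdsWithin] with z hz using hf.smul_eq z hz)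
  obtain ⟨-, -, ρ, hρ, h1, h2⟩ := hr
  have hρt : Tendsto ρ (𝓝 a) (𝓝 b) := h1 ▸ hρ.continuousAt.tendsto
  have heq : ∀ᶠ z in 𝓝 a, z ∈ J → f z = ρ z := by
    refine eventually_nhdsWithin_iff.1 ?_
    refine (H.immersedAt hb).eventually_eq ht (hρt.mono_left nhdsWithin_le_nhds) ?_
    filter_upwards [self_mem_nhdsWithin, nhdsWithin_le_nhds h2] with z hz1 hz2
    rw [← hf.smul_eq z hz1, hz2]
  obtain ⟨ε, hε, hball⟩ := Metric.eventually_nhds_iff_ball.1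
    (((H.isOpen.eventually_mem ha).and (hρt.eventually (H.isOpen.eventually_mem hb))).and
      (hρ.eventually_analyticAt.and (h2.and heq)))
  obtain ⟨w, hw⟩ : (Metric.ball a ε ∩ J).Nonempty :=
    nonempty_of_mem (f := 𝓝[J] a) (inter_mem (nhdsWithin_le_nhds (Metric.ball_mem_nhds a hε))
      self_mem_nhdsWithin)
  set f' : ℝ → ℝ := fun z => if z ∈ J then f z else ρ z with hf'
  have hJ' : EqOn f' f J := fun z hz => if_pos hz
  have hB' : EqOn f' ρ (Metric.ball a ε) := by
    intro z hz
    by_cases hzJ : z ∈ J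
    · rw [hJ' hzJ, (hball z hz).2.2.2 hzJ]
    · exact if_neg hzJ
  refine haJ (hmax (J ∪ Metric.ball a ε) f' ⟨?_, ?_, Or.inl hf.mem, ?_, ?_, ?_, ?_, ?_⟩
    (Or.inr (Metric.mem_ball_self hε)))
  · exact hf.isOpen.union Metric.isOpen_ball
  · refine (IsPreconnected.union w hw.2 hw.1 hf.ordConnected.isPreconnected ?_).ordConnected
    exact (convex_ball a ε).isPreconnected
  · exact union_subset hf.subset fun z hz => (hball z hz).1.1
  · rintro z (hz | hz)
    · rw [hJ' hz]; exact hf.mapsTo hz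
    · rw [hB' hz]; exact (hball z hz).1.2
  · rintro z (hz | hz)
    · refine (hf.analytic z hz).congr ?_
      filter_upwards [hf.isOpen.mem_nhds hz] with w hw using (hJ' hw).symm
    · refine (hball z hz).2.1.congr ?_
      filter_upwards [Metric.isOpen_ball.mem_nhds hz] with w hw using (hB' hw).symm
  · rw [hJ' hf.mem, hf.apply_eq]
  · rintro z (hz | hz)
    · rw [hJ' hz]; exact hf.smul_eq z hz
    · rw [hB' hz]; exact (hball z hz).2.2.1

end Shifts

/-! ### Shifts: continued germ relations of a free action -/

section ShiftStructure

variable {E : Type*} [NormedAddCommGroup E] [NormedSpace ℝ E]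
variable {G : Type*} [Group G]
variable {M : Type*} [TopologicalSpace M] [ChartedSpace E M] [MulAction G M]

/-- `f : J → K` is an increasing analytic diffeomorphism with inverse `σ` between open subsets
`J`, `K` of `I`, where `J` is a lower set and `K` an upper set in `I`, such that
`h • γ = γ ∘ f` on `J`. -/
structure IsShift (γ : ℝ → M) (I : Set ℝ) (h : G) (f : ℝ → ℝ) (J : Set ℝ) (σ : ℝ → ℝ)
    (K : Set ℝ) : Prop where
  isOpen_left : IsOpen J
  isOpen_right : IsOpen K
  subset_left : J ⊆ I
  subset_right : K ⊆ I
  mapsTo : MapsTo f J K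
  mapsTo_symm : MapsTo σ K J
  invOn : InvOn σ f J K
  analytic : AnalyticOnNhd ℝ f J
  analytic_symm : AnalyticOnNhd ℝ σ K
  strictMonoOn : StrictMonoOn f J
  lower : ∀ z ∈ I, ∀ w ∈ J, z ≤ w → z ∈ J
  upper : ∀ z ∈ I, ∀ w ∈ K, w ≤ z → z ∈ K
  smul_eq : ∀ z ∈ J, h • γ z = γ (f z)

namespace IsShift

variable {γ : ℝ → M} {I : Set ℝ} {h k : G} {f g σ τ : ℝ → ℝ} {J K J' K' : Set ℝ}

theorem strictMonoOn_symm (s : IsShift γ I h f J σ K) : StrictMonoOn σ K := by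
  intro a ha b hb hab
  rw [← s.strictMonoOn.lt_iff_lt (s.mapsTo_symm ha) (s.mapsTo_symm hb), s.invOn.2 ha, s.invOn.2 hb]
  exact hab

theorem smul_eq_symm (s : IsShift γ I h f J σ K) {z : ℝ} (hz : z ∈ K) :
    h⁻¹ • γ z = γ (σ z) := by
  rw [inv_smul_eq_iff, s.smul_eq _ (s.mapsTo_symm hz), s.invOn.2 hz]

theorem germRel (s : IsShift γ I h f J σ K) {z : ℝ} (hz : z ∈ J) : GermRel γ I h z (f z) :=
  germRel_of_analyticOnNhd s.isOpen_left s.subset_left s.analytic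
    (fun _ hw => s.subset_right (s.mapsTo hw)) s.smul_eq hz

theorem germRel_symm (s : IsShift γ I h f J σ K) {z : ℝ} (hz : z ∈ K) :
    GermRel γ I h⁻¹ z (σ z) :=
  germRel_of_analyticOnNhd (f := σ) s.isOpen_right s.subset_right s.analytic_symm
    (fun _ hw => s.subset_left (s.mapsTo_symm hw)) (fun w hw => s.smul_eq_symm (z := w) hw) hz

theorem ordConnected_left (s : IsShift γ I h f J σ K) (hI : I.OrdConnected) : J.OrdConnected :=
  ⟨fun _ hx _ hy _ hz =>
    s.lower _ (hI.out (s.subset_left hx) (s.subset_left hy) hz) _ hy hz.2⟩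

theorem ordConnected_right (s : IsShift γ I h f J σ K) (hI : I.OrdConnected) : K.OrdConnected :=
  ⟨fun _ hx _ hy _ hz =>
    s.upper _ (hI.out (s.subset_right hx) (s.subset_right hy) hz) _ hx hz.1⟩

theorem refl (hI : IsOpen I) : IsShift γ I (1 : G) id I id I :=
  ⟨hI, hI, subset_rfl, subset_rfl, mapsTo_id I, mapsTo_id I, ⟨fun _ _ => rfl, fun _ _ => rfl⟩,
    analyticOnNhd_id, analyticOnNhd_id, strictMono_id.strictMonoOn I, fun _ hz _ _ _ => hz,
    fun _ hz _ _ _ => hz, fun _ _ => one_smul _ _⟩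

theorem trans (s : IsShift γ I h f J σ K) (t : IsShift γ I k g J' τ K') :
    IsShift γ I (k * h) (g ∘ f) {z ∈ J | f z ∈ J'} (σ ∘ τ) {z ∈ K' | τ z ∈ K} where
  isOpen_left := s.analytic.continuousOn.isOpen_inter_preimage s.isOpen_left t.isOpen_left
  isOpen_right := t.analytic_symm.continuousOn.isOpen_inter_preimage t.isOpen_right s.isOpen_right
  subset_left z hz := s.subset_left hz.1
  subset_right z hz := t.subset_right hz.1
  mapsTo z hz := ⟨t.mapsTo hz.2, by
    simpa only [Function.comp, t.invOn.1 hz.2] using s.mapsTo hz.1⟩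
  mapsTo_symm z hz := ⟨s.mapsTo_symm hz.2, by
    simpa only [Function.comp, s.invOn.2 hz.2] using t.mapsTo_symm hz.1⟩
  invOn := ⟨fun z hz => by simp only [Function.comp, t.invOn.1 hz.2, s.invOn.1 hz.1],
    fun z hz => by simp only [Function.comp, s.invOn.2 hz.2, t.invOn.2 hz.1]⟩
  analytic z hz := (t.analytic _ hz.2).comp (s.analytic z hz.1)
  analytic_symm z hz := (s.analytic_symm _ hz.2).comp (t.analytic_symm z hz.1)
  strictMonoOn a ha b hb hab := t.strictMonoOn ha.2 hb.2 (s.strictMonoOn ha.1 hb.1 hab)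
  lower z hz w hw hzw := by
    have h1 := s.lower z hz w hw.1 hzw
    exact ⟨h1, t.lower _ (s.subset_right (s.mapsTo h1)) _ hw.2
      (s.strictMonoOn.monotoneOn h1 hw.1 hzw)⟩
  upper z hz w hw hzw := by
    have h1 := t.upper z hz w hw.1 hzw
    exact ⟨h1, s.upper _ (t.subset_left (t.mapsTo_symm h1)) _ hw.2
      (t.strictMonoOn_symm.monotoneOn hw.1 h1 hzw)⟩
  smul_eq z hz := by
    rw [mul_smul, s.smul_eq z hz.1, t.smul_eq _ hz.2]
    rfl

end IsShift

variable {γ : ℝ → M} {I : Set ℝ} {h : G} {x y : ℝ} {J : Set ℝ} {f : ℝ → ℝ}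

theorem IsExtension.strictMonoOn_or_strictAntiOn (H : IsImmersedOn E G γ I) (hf : IsExtension γ I h x y J f) :
    StrictMonoOn f J ∨ StrictAntiOn f J := by
  have hd : ∀ z ∈ J, deriv f z ≠ 0 := fun z hz =>
    (H.smul_immersedAt h z (hf.subset hz)).deriv_reparam_ne_zero (H.immersedAt (hf.mapsTo hz))
      (hf.analytic z hz) (Filter.mem_of_superset (hf.isOpen.mem_nhds hz) hf.smul_eq)
  have hc : Convex ℝ J := hf.ordConnected.convex
  have hcont := hf.analytic.continuousOn
  rcases hasDerivWithinAt_forall_lt_or_forall_gt_of_forall_ne hc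
    (fun z hz => (hf.analytic z hz).differentiableAt.hasDerivAt.hasDerivWithinAt) hd with h1 | h1
  · exact Or.inr (strictAntiOn_of_deriv_neg hc hcont fun z hz => h1 z (interior_subset hz))
  · exact Or.inl (strictMonoOn_of_deriv_pos hc hcont fun z hz => h1 z (interior_subset hz))

/-- A fixed point of `f` would give `h` a fixed point in `M`, so `h = 1` and `f` would be the
identity, contrary to `f x = y > x`. Without fixed points, the sign of `f z - z` is constant. -/
theorem IsExtension.lt_apply (H : IsImmersedOn E G γ I)
    (hfree : ∀ (g : G) (x : M), g • x = x → g = 1) (hf : IsExtension γ I h x y J f) (hxy : x < y)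
    {z : ℝ} (hz : z ∈ J) : z < f z := by
  have hfix : ∀ w ∈ J, f w ≠ w := by
    intro w hw hfw
    have h1 : h = 1 := hfree h (γ w) (by rw [hf.smul_eq w hw, hfw])
    have hev : f =ᶠ[𝓝 w] id := by
      refine (H.immersedAt (hf.subset hw)).eventually_eq ?_ tendsto_id ?_
      · simpa [hfw] using (hf.analytic w hw).continuousAt.tendsto
      · filter_upwards [hf.isOpen.mem_nhds hw] with v hv
        rw [← hf.smul_eq v hv, h1, one_smul]
        rfl
    have := hf.analytic.eqOn_of_preconnected_of_eventuallyEq analyticOnNhd_id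
      hf.ordConnected.isPreconnected hw hev hf.mem
    rw [hf.apply_eq] at this
    exact hxy.ne' this
  by_contra hlt
  have hcont : ContinuousOn (fun z => f z - z) J := hf.analytic.continuousOn.sub continuousOn_id
  obtain ⟨w, hw, h0⟩ := hf.ordConnected.isPreconnected.intermediate_value hz hf.mem hcont
    (show (0 : ℝ) ∈ Icc _ _ from ⟨by linarith, by rw [hf.apply_eq]; linarith⟩)
  exact hfix w hw (by simpa [sub_eq_zero] using h0)

theorem neBot_nhdsWithin_csSup {J : Set ℝ} (hne : J.Nonempty) (hb : BddAbove J) :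
    (𝓝[J] (sSup J)).NeBot :=
  mem_closure_iff_nhdsWithin_neBot.1 (csSup_mem_closure hne hb)

theorem neBot_nhdsWithin_csInf {J : Set ℝ} (hne : J.Nonempty) (hb : BddBelow J) :
    (𝓝[J] (sInf J)).NeBot :=
  mem_closure_iff_nhdsWithin_neBot.1 (csInf_mem_closure hne hb)

theorem tendsto_csSup_of_monotoneOn {J : Set ℝ} {f : ℝ → ℝ} (hne : J.Nonempty) (hJ : BddAbove J)
    (hs : sSup J ∉ J) (hf : MonotoneOn f J) (hb : BddAbove (f '' J)) :
    Tendsto f (𝓝[J] (sSup J)) (𝓝 (sSup (f '' J))) := by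
  refine tendsto_order.2 ⟨fun l hl => ?_, fun m hm => ?_⟩
  · obtain ⟨_, ⟨z, hz, rfl⟩, lz⟩ := exists_lt_of_lt_csSup (hne.image f) hl
    have : z < sSup J := lt_of_le_of_ne (le_csSup hJ hz) fun h => hs (h ▸ hz)
    filter_upwards [self_mem_nhdsWithin, nhdsWithin_le_nhds (Ioi_mem_nhds this)] with w hw hzw
    exact lz.trans_le (hf hz hw (le_of_lt hzw))
  · filter_upwards [self_mem_nhdsWithin] with w hw
    exact (le_csSup hb (mem_image_of_mem f hw)).trans_lt hm

theorem tendsto_csSup_of_antitoneOn {J : Set ℝ} {f : ℝ → ℝ} (hne : J.Nonempty) (hJ : BddAbove J)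
    (hs : sSup J ∉ J) (hf : AntitoneOn f J) (hb : BddBelow (f '' J)) :
    Tendsto f (𝓝[J] (sSup J)) (𝓝 (sInf (f '' J))) := by
  refine tendsto_order.2 ⟨fun l hl => ?_, fun m hm => ?_⟩
  · filter_upwards [self_mem_nhdsWithin] with w hw
    exact hl.trans_le (csInf_le hb (mem_image_of_mem f hw))
  · obtain ⟨_, ⟨z, hz, rfl⟩, lz⟩ := exists_lt_of_csInf_lt (hne.image f) hm
    have : z < sSup J := lt_of_le_of_ne (le_csSup hJ hz) fun h => hs (h ▸ hz)
    filter_upwards [self_mem_nhdsWithin, nhdsWithin_le_nhds (Ioi_mem_nhds this)] with w hw hzw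
    exact (hf hz hw (le_of_lt hzw)).trans_lt lz

theorem tendsto_csInf_of_monotoneOn {J : Set ℝ} {f : ℝ → ℝ} (hne : J.Nonempty) (hJ : BddBelow J)
    (hs : sInf J ∉ J) (hf : MonotoneOn f J) (hb : BddBelow (f '' J)) :
    Tendsto f (𝓝[J] (sInf J)) (𝓝 (sInf (f '' J))) := by
  refine tendsto_order.2 ⟨fun l hl => ?_, fun m hm => ?_⟩
  · filter_upwards [self_mem_nhdsWithin] with w hw
    exact hl.trans_le (csInf_le hb (mem_image_of_mem f hw))
  · obtain ⟨_, ⟨z, hz, rfl⟩, lz⟩ := exists_lt_of_csInf_lt (hne.image f) hm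
    have : sInf J < z := lt_of_le_of_ne (csInf_le hJ hz) fun h => hs (h ▸ hz)
    filter_upwards [self_mem_nhdsWithin, nhdsWithin_le_nhds (Iio_mem_nhds this)] with w hw hzw
    exact (hf hw hz (le_of_lt hzw)).trans_lt lz

theorem csSup_notMem_of_isOpen {J : Set ℝ} (hJ : IsOpen J) (hb : BddAbove J) : sSup J ∉ J := by
  intro hm
  obtain ⟨z, hz, hlt⟩ := (mem_nhdsGT_iff_exists_Ioo_subset.1
    (nhdsWithin_le_nhds (hJ.mem_nhds hm)))
  obtain ⟨w, hw⟩ := exists_between (show sSup J < z from hz)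
  exact absurd (le_csSup hb (hlt hw)) (not_le.2 hw.1)

theorem csInf_notMem_of_isOpen {J : Set ℝ} (hJ : IsOpen J) (hb : BddBelow J) : sInf J ∉ J := by
  intro hm
  obtain ⟨z, hz, hlt⟩ := (mem_nhdsLT_iff_exists_Ioo_subset.1
    (nhdsWithin_le_nhds (hJ.mem_nhds hm)))
  obtain ⟨w, hw⟩ := exists_between (show z < sInf J from hz)
  exact absurd (csInf_le hb (hlt hw)) (not_le.2 hw.2)

/-- If `f` were decreasing, then `z < f z ≤ y` to the right of `x` would confine `J` below `y`, and
similarly `f '' J` above `x`. So `f` would converge at `sSup J`, with both the point and the limit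
in `[x, y] ⊆ I`, contradicting maximality. -/
theorem IsExtension.strictMonoOn [T2Space M] (H : IsImmersedOn E G γ I)
    (hfree : ∀ (g : G) (x : M), g • x = x → g = 1) (hf : IsExtension γ I h x y J f) (hxy : x < y)
    (hmax : ∀ J' f', IsExtension γ I h x y J' f' → J' ⊆ J) : StrictMonoOn f J := by
  refine (hf.strictMonoOn_or_strictAntiOn H).resolve_right fun hanti => ?_
  have hx : x ∈ I := hf.subset hf.mem
  have hy : y ∈ I := hf.apply_eq ▸ hf.mapsTo hf.mem
  have hbJ : ∀ z ∈ J, z ≤ y := by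
    intro z hz
    rcases le_total z x with hzx | hzx
    · linarith
    · have h1 := hf.lt_apply H hfree hxy hz
      have h2 := hanti.antitoneOn hf.mem hz hzx
      rw [hf.apply_eq] at h2
      linarith
  have hbK : ∀ w ∈ f '' J, x ≤ w := by
    rintro _ ⟨z, hz, rfl⟩
    rcases le_total z x with hzx | hzx
    · have h2 := hanti.antitoneOn hz hf.mem hzx
      rw [hf.apply_eq] at h2
      linarith
    · have h1 := hf.lt_apply H hfree hxy hz
      linarith
  have hne : J.Nonempty := ⟨x, hf.mem⟩
  have hJ : BddAbove J := ⟨y, hbJ⟩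
  have hK : BddBelow (f '' J) := ⟨x, hbK⟩
  have hnot := csSup_notMem_of_isOpen hf.isOpen hJ
  have := neBot_nhdsWithin_csSup hne hJ
  refine hf.not_tendsto_of_maximal H hmax
    (H.ordConnected.out hx hy ⟨le_csSup hJ hf.mem, csSup_le hne hbJ⟩) hnot
    (H.ordConnected.out hx hy ⟨le_csInf (hne.image f) hbK, ?_⟩)
    (tendsto_csSup_of_antitoneOn hne hJ hnot hanti.antitoneOn hK)
  exact csInf_le hK ⟨x, hf.mem, hf.apply_eq⟩

/-- A germ relation between different parameters of a free action extends to a shift. -/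
theorem GermRel.exists_shift [T2Space M] (H : IsImmersedOn E G γ I)
    (hfree : ∀ (g : G) (x : M), g • x = x → g = 1) (hr : GermRel γ I h x y) (hxy : x < y) :
    ∃ f J σ K, IsShift γ I h f J σ K ∧ x ∈ J ∧ f x = y ∧ ∀ z ∈ J, z < f z := by
  obtain ⟨J, f, hf, hmax⟩ := hr.exists_maximal_extension H
  have hmono := hf.strictMonoOn H hfree hxy hmax
  have hlt : ∀ z ∈ J, z < f z := fun z hz => hf.lt_apply H hfree hxy hz
  have hne : J.Nonempty := ⟨x, hf.mem⟩
  have hg : ∀ z ∈ J, GermRel γ I h z (f z) := fun z hz =>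
    germRel_of_analyticOnNhd hf.isOpen hf.subset hf.analytic hf.mapsTo hf.smul_eq hz
  -- The reversed germ is an analytic local right inverse of `f`; it shows both that the image is
  -- open and that the global inverse is analytic.
  have hloc : ∀ z ∈ J, ∃ ρ : ℝ → ℝ, AnalyticAt ℝ ρ (f z) ∧
      ∀ᶠ w in 𝓝 (f z), ρ w ∈ J ∧ f (ρ w) = w := by
    intro z hz
    obtain ⟨h1, h2, ρ, hρ, h3, h4⟩ := (hg z hz).symm H
    have hρt : Tendsto ρ (𝓝 (f z)) (𝓝 z) := by simpa [h3] using hρ.continuousAt.tendsto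
    have hJ : ∀ᶠ w in 𝓝 (f z), ρ w ∈ J := hρt.eventually (hf.isOpen.mem_nhds hz)
    refine ⟨ρ, hρ, hJ.and ?_⟩
    refine (H.immersedAt h1).eventually_eq ((hf.analytic z hz).continuousAt.tendsto.comp hρt)
      tendsto_id ?_
    filter_upwards [hJ, h4] with w hw1 hw2
    rw [← hf.smul_eq _ hw1, ← hw2, smul_inv_smul]
  set σ := Function.invFunOn f J with hσ
  have hσf : LeftInvOn σ f J := hmono.injOn.leftInvOn_invFunOn
  have hfσ : RightInvOn σ f (f '' J) := by
    rintro _ ⟨z, hz, rfl⟩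
    rw [hσf hz]
  refine ⟨f, J, σ, f '' J, ⟨hf.isOpen, ?_, hf.subset, hf.mapsTo.image_subset, mapsTo_image f J,
    ?_, ⟨hσf, hfσ⟩, hf.analytic, ?_, hmono, ?_, ?_, hf.smul_eq⟩, hf.mem, hf.apply_eq, hlt⟩
  · rw [isOpen_iff_mem_nhds]
    rintro _ ⟨z, hz, rfl⟩
    obtain ⟨ρ, -, h2⟩ := hloc z hz
    filter_upwards [h2] with w hw using ⟨ρ w, hw.1, hw.2⟩
  · rintro _ ⟨z, hz, rfl⟩
    rwa [hσf hz]
  · rintro _ ⟨z, hz, rfl⟩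
    obtain ⟨ρ, h1, h2⟩ := hloc z hz
    refine h1.congr ?_
    filter_upwards [h2] with w hw
    rw [← hσf hw.1, hw.2]
  -- If `J` stopped inside `I` on the left, then `sInf J ≤ f v` on `J` by `v < f v`, so the
  -- increasing `f` would have a limit in `I` at `sInf J`, against maximality.
  · intro z hz w hw hzw
    by_contra hzJ
    have hlow : ∀ v ∈ J, z ≤ v := fun v hv => by
      by_contra hvz
      exact hzJ (hf.ordConnected.out hv hw ⟨(not_le.1 hvz).le, hzw⟩)
    have hb : BddBelow J := ⟨z, hlow⟩
    have hbK : ∀ v ∈ f '' J, sInf J ≤ v := by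
      rintro _ ⟨v, hv, rfl⟩
      exact (csInf_le hb hv).trans (hlt v hv).le
    have hK : BddBelow (f '' J) := ⟨_, hbK⟩
    have hnot := csInf_notMem_of_isOpen hf.isOpen hb
    have := neBot_nhdsWithin_csInf hne hb
    have ha : sInf J ∈ I := H.ordConnected.out hz (hf.subset hw) ⟨le_csInf hne hlow, csInf_le hb hw⟩
    exact hf.not_tendsto_of_maximal H hmax ha hnot
      (H.ordConnected.out ha (hf.mapsTo hw) ⟨le_csInf (hne.image f) hbK, csInf_le hK ⟨w, hw, rfl⟩⟩)
      (tendsto_csInf_of_monotoneOn hne hb hnot hmono.monotoneOn hK)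
  -- If the image stopped at some `z ∈ I`, then `v < f v ≤ z` would bound `J` as well, and `f` would
  -- have a limit in `I` at `sSup J ∈ I`.
  · rintro z hz _ ⟨w, hw, rfl⟩ hwz
    by_contra hzK
    have hconn : (f '' J).OrdConnected :=
      (hf.ordConnected.isPreconnected.image f hf.analytic.continuousOn).ordConnected
    have hbK : ∀ v ∈ f '' J, v ≤ z := fun v hv => by
      by_contra hvz
      exact hzK (hconn.out ⟨w, hw, rfl⟩ hv ⟨hwz, (not_le.1 hvz).le⟩)
    have hK : BddAbove (f '' J) := ⟨z, hbK⟩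
    have hbJ : ∀ v ∈ J, v ≤ z := fun v hv => (hlt v hv).le.trans (hbK _ ⟨v, hv, rfl⟩)
    have hb : BddAbove J := ⟨z, hbJ⟩
    have hnot := csSup_notMem_of_isOpen hf.isOpen hb
    have := neBot_nhdsWithin_csSup hne hb
    exact hf.not_tendsto_of_maximal H hmax
      (H.ordConnected.out (hf.subset hw) hz ⟨le_csSup hb hw, csSup_le hne hbJ⟩) hnot
      (H.ordConnected.out (hf.mapsTo hw) hz
        ⟨le_csSup hK ⟨w, hw, rfl⟩, csSup_le (hne.image f) hbK⟩)
      (tendsto_csSup_of_monotoneOn hne hb hnot hmono.monotoneOn hK)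

end ShiftStructure

/-! ### Overlaps of segments versus germ relations -/

section Overlaps

variable {E : Type*} [NormedAddCommGroup E] [NormedSpace ℝ E]
variable {G : Type*} [Group G]
variable {M : Type*} [TopologicalSpace M] [ChartedSpace E M] [MulAction G M]
variable {γ : ℝ → M} {I : Set ℝ}

theorem isOpenInterval_Ioo {a b : ℝ} (h : a < b) : IsOpenInterval (Ioo a b) :=
  ⟨isOpen_Ioo, isConnected_Ioo h, by simpa using h⟩

theorem IsOpenInterval.of_ordConnected {J : Set ℝ} (hJ : IsOpen J) (hc : J.OrdConnected)
    (hne : J.Nonempty) : IsOpenInterval J :=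
  ⟨hJ, ⟨hne, hc.isPreconnected⟩, by rwa [hJ.interior_eq]⟩

/-- Since `γ` is an embedding on `J'`, the parameter `τ s` of the point `h • γ s` depends
continuously on `s`, which is what the accumulation criterion requires. -/
theorem exists_germRel_of_overlap [T2Space M] (H : IsImmersedOn E G γ I) {h : G} {D : Set ℝ}
    (hD : D ⊆ I) (ho : Overlap E (fun t => h • γ t) D γ D) :
    ∃ s ∈ interior D, ∃ t ∈ interior D, GermRel γ I h s t := by
  obtain ⟨J, J', hJ, hJ', hJD, hJD', -, ⟨-, U, δ, -, hU, hδ, -, hemb⟩, heq⟩ := ho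
  obtain ⟨s₀, hs₀⟩ := hJ.2.1.1
  have hex : ∀ s : J, ∃ t ∈ J', γ t = h • γ s := fun s => by
    have : h • γ s ∈ γ '' J' := heq ▸ ⟨s, s.2, rfl⟩
    exact this
  choose τ hτ hτe using hex
  refine ⟨s₀, hJ.1.subset_interior_iff.2 hJD hs₀, τ ⟨s₀, hs₀⟩,
    hJ'.1.subset_interior_iff.2 hJD' (hτ _), ?_⟩
  -- The map `τ` lives on the subtype `J` only, so the punctured neighbourhood filter is pulled back
  -- to it.
  have hne : (comap ((↑) : J → ℝ) (𝓝[≠] s₀)).NeBot := by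
    rw [comap_neBot_iff_frequently]
    refine Eventually.frequently ?_
    filter_upwards [nhdsWithin_le_nhds (hJ.1.mem_nhds hs₀)] with z hz using ⟨⟨z, hz⟩, rfl⟩
  refine H.germRel_of_tendsto (l := comap ((↑) : J → ℝ) (𝓝[≠] s₀)) (σ := (↑)) (τ := τ)
    (hD (hJD hs₀)) (hD (hJD' (hτ _))) tendsto_comap ?_ (Eventually.of_forall fun s => (hτe s).symm)
  have hcont : Tendsto (fun s : J => (⟨τ s, hU (hτ s)⟩ : U)) (comap ((↑) : J → ℝ) (𝓝[≠] s₀))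
      (𝓝 ⟨τ ⟨s₀, hs₀⟩, hU (hτ _)⟩) := by
    rw [hemb.isInducing.tendsto_nhds_iff]
    have h1 : ∀ s : J, U.domRestrict δ ⟨τ s, hU (hτ s)⟩ = h • γ s := fun s => by
      change δ (τ s) = _
      rw [hδ (hτ s), hτe]
    simp only [Function.comp_def, h1]
    have h2 := (H.smul_immersedAt h s₀ (hD (hJD hs₀))).continuousAt.tendsto
    exact (h2.mono_left nhdsWithin_le_nhds).comp tendsto_comap
  exact (continuous_subtype_val.tendsto _).comp hcont

/-- On a compact neighbourhood where the curve is injective it is a topological embedding, and this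
passes to all subintervals. -/
theorem eventually_isAnalyticEmbedding [T2Space M] (H : IsImmersedOn E G γ I)
    (hO : ∀ h : G, IsOpenAnalyticImmersion E (fun s => h • γ s) I) (h : G) {t : ℝ} (ht : t ∈ I) :
    ∃ V ∈ 𝓝 t, ∀ J ⊆ V, IsOpenInterval J → IsAnalyticEmbedding E (fun s => h • γ s) J := by
  have h1 := (H.smul_immersedAt h t ht).eventually_injective
  rw [nhds_prod_eq] at h1
  obtain ⟨V, hV, hinj⟩ := (eventually_prod_self_iff (r := fun a b => h • γ a = h • γ b → a = b)).1 h1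
  obtain ⟨K, hK, hKV, hKc⟩ := local_compact_nhds (inter_mem hV (H.isOpen.mem_nhds ht))
  refine ⟨K, hK, fun J hJ hJo => ⟨hJo.2, J, fun s => h • γ s, hJo, subset_rfl, fun _ _ => rfl,
    ⟨(hO h).1.mono fun s hs => (hKV (hJ hs)).2, fun s hs => (hO h).2 s (hKV (hJ hs)).2⟩, ?_⟩⟩
  have hc : ContinuousOn (fun s => h • γ s) K := fun s hs =>
    (H.smul_immersedAt h s (hKV hs).2).continuousAt.continuousWithinAt
  have : CompactSpace K := isCompact_iff_compactSpace.1 hKc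
  have hemb : IsEmbedding (K.domRestrict (fun s => h • γ s)) := by
    refine (Continuous.isClosedEmbedding (continuousOn_iff_continuous_domRestrict.1 hc) ?_).isEmbedding
    intro a b hab
    exact Subtype.ext (hinj _ (hKV a.2).1 _ (hKV b.2).1 hab)
  exact hemb.comp (IsEmbedding.inclusion hJ)

theorem IsShift.overlap [T2Space M] (H : IsImmersedOn E G γ I)
    (hO : ∀ h : G, IsOpenAnalyticImmersion E (fun s => h • γ s) I) {h : G} {f σ : ℝ → ℝ}
    {J K D : Set ℝ} (s : IsShift γ I h f J σ K) {x : ℝ} (hx : x ∈ J) (hxD : D ∈ 𝓝 x)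
    (hyD : D ∈ 𝓝 (f x)) : Overlap E (fun t => h • γ t) D γ D := by
  obtain ⟨V, hV, hVe⟩ := eventually_isAnalyticEmbedding H hO h (s.subset_left hx)
  obtain ⟨W, hW, hWe⟩ := eventually_isAnalyticEmbedding H hO 1 (s.subset_right (s.mapsTo hx))
  simp only [one_smul] at hWe
  have hfc := (s.analytic x hx).continuousAt
  have hmem : (V ∩ D) ∩ (J ∩ f ⁻¹' (W ∩ D)) ∈ 𝓝 x :=
    inter_mem (inter_mem hV hxD) (inter_mem (s.isOpen_left.mem_nhds hx) (hfc (inter_mem hW hyD)))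
  obtain ⟨ε, hε, hball⟩ := Metric.mem_nhds_iff.1 hmem
  rw [Real.ball_eq_Ioo] at hball
  set L := Ioo (x - ε) (x + ε) with hL
  have hLo : IsOpenInterval L := isOpenInterval_Ioo (by linarith)
  -- Written as a preimage under `σ`, the image of `L` is visibly open.
  have himg : f '' L = K ∩ σ ⁻¹' L := by
    ext w
    constructor
    · rintro ⟨z, hz, rfl⟩
      exact ⟨s.mapsTo (hball hz).2.1, by rwa [mem_preimage, s.invOn.1 (hball hz).2.1]⟩
    · rintro ⟨hw, hwL⟩
      exact ⟨σ w, hwL, s.invOn.2 hw⟩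
  have hfL : IsOpenInterval (f '' L) := by
    refine IsOpenInterval.of_ordConnected ?_ ?_ (hLo.2.1.1.image f)
    · rw [himg]
      exact s.analytic_symm.continuousOn.isOpen_inter_preimage s.isOpen_right isOpen_Ioo
    · exact (isPreconnected_Ioo.image f
        (s.analytic.continuousOn.mono fun z hz => (hball hz).2.1)).ordConnected
  refine ⟨L, f '' L, hLo, hfL, fun z hz => (hball hz).1.2, ?_, hVe L (fun z hz => (hball hz).1.1)
    hLo, hWe _ ?_ hfL, ?_⟩
  · rintro _ ⟨z, hz, rfl⟩
    exact (hball hz).2.2.2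
  · rintro _ ⟨z, hz, rfl⟩
    exact (hball hz).2.2.1
  · rw [image_image]
    exact image_congr fun z hz => s.smul_eq z (hball hz).2.1

/-- The relation produces an overlap inside `D`, so `h` fixes `γ` on the free segment, and freeness
of the action gives `h = 1`. The case `s > t` is reduced to `s < t` by inverting. -/
theorem eq_one_of_germRel [T2Space M] (H : IsImmersedOn E G γ I)
    (hO : ∀ h : G, IsOpenAnalyticImmersion E (fun s => h • γ s) I)
    (hfree : ∀ (g : G) (x : M), g • x = x → g = 1) {h : G} {s t : ℝ} {D : Set ℝ}
    (hD : IsFreeSegment E G γ D) (hs : D ∈ 𝓝 s) (ht : D ∈ 𝓝 t) (hr : GermRel γ I h s t)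
    (hst : s ≠ t) : h = 1 := by
  rcases lt_or_gt_of_ne hst with hlt | hlt
  · obtain ⟨f, J, σ, K, hf, hsJ, rfl, -⟩ := hr.exists_shift H hfree hlt
    exact hfree h _ (hD.2 h (hf.overlap H hO hsJ hs ht) s (mem_of_mem_nhds hs))
  · obtain ⟨f, J, σ, K, hf, hsJ, rfl, -⟩ := (hr.symm H).exists_shift H hfree hlt
    exact inv_eq_one.1 (hfree _ _ (hD.2 _ (hf.overlap H hO hsJ ht hs) t (mem_of_mem_nhds ht)))

end Overlaps

/-! ### Discreteness of germ relations from satedness -/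

section Discreteness

variable {E : Type*} [NormedAddCommGroup E] [NormedSpace ℝ E]
variable (G : Type*) [Group G]
variable {M : Type*} [TopologicalSpace M] [ChartedSpace E M] [MulAction G M]

/-- Distinct parameters near `q` are not related by any group element. -/
def IsDiscreteAt (γ : ℝ → M) (I : Set ℝ) (q : ℝ) : Prop :=
  ∀ᶠ p : ℝ × ℝ in 𝓝 (q, q), ∀ h : G, GermRel γ I h p.1 p.2 → p.1 = p.2

variable {G} {γ : ℝ → M} {I : Set ℝ}

theorem isOpen_isDiscreteAt : IsOpen {q | IsDiscreteAt G γ I q} := by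
  rw [isOpen_iff_mem_nhds]
  intro q hq
  have h1 := eventually_eventually_nhds.2 hq
  have h2 : Tendsto (fun z : ℝ => (z, z)) (𝓝 q) (𝓝 (q, q)) :=
    tendsto_id.prodMk_nhds tendsto_id
  exact h2.eventually h1

/-- Conjugation: a relation by `k` near `q'` is transported by the local reparametrization `ρ` to a
relation by `h⁻¹ * (k * h)` near `q`. -/
theorem IsDiscreteAt.of_germRel [T2Space M] (H : IsImmersedOn E G γ I) {h : G} {q q' : ℝ}
    (hq : IsDiscreteAt G γ I q) (hr : GermRel γ I h q q') : IsDiscreteAt G γ I q' := by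
  obtain ⟨hq', hqI, ρ, hρ, h1, h2⟩ := hr.symm H
  have hρt : Tendsto ρ (𝓝 q') (𝓝 q) := h1 ▸ hρ.continuousAt.tendsto
  have hev : ∀ᶠ x in 𝓝 q', GermRel γ I h⁻¹ x (ρ x) := by
    filter_upwards [hρ.eventually_analyticAt, eventually_eventually_nhds.2 h2,
      H.isOpen.mem_nhds hq', hρt.eventually (H.isOpen.mem_nhds hqI)] with x hx1 hx2 hx3 hx4
    exact ⟨hx3, hx4, ρ, hx1, rfl, hx2⟩
  have hp : Tendsto (fun p : ℝ × ℝ => (ρ p.1, ρ p.2)) (𝓝 (q', q')) (𝓝 (q, q)) :=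
    (hρt.comp (continuous_fst.tendsto (q', q'))).prodMk_nhds
      (hρt.comp (continuous_snd.tendsto (q', q')))
  filter_upwards [hp.eventually hq, (H.immersedAt hq').eventually_injective,
    (continuousAt_fst (p := (q', q'))).eventually hev,
    (continuousAt_snd (p := (q', q'))).eventually hev] with p hp1 hp2 hp3 hp4 k hk
  have h5 := hp1 _ (((hp3.symm H).trans hk).trans hp4)
  apply hp2
  have h6 := hp3.smul_eq
  rw [h5, ← hp4.smul_eq] at h6
  exact MulAction.injective h⁻¹ h6

theorem isDiscreteAt_of_isFreeSegment [T2Space M] (H : IsImmersedOn E G γ I)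
    (hO : ∀ h : G, IsOpenAnalyticImmersion E (fun s => h • γ s) I)
    (hfree : ∀ (g : G) (x : M), g • x = x → g = 1) {t : ℝ} {D : Set ℝ} (htI : t ∈ I)
    (hD : IsFreeSegment E G γ D) (ht : D ∈ 𝓝 t) : IsDiscreteAt G γ I t := by
  have h1 := eventually_mem_nhds_iff.2 ht
  filter_upwards [(H.immersedAt htI).eventually_injective,
    (continuousAt_fst (p := (t, t))).eventually h1,
    (continuousAt_snd (p := (t, t))).eventually h1] with p hp1 hp2 hp3 h hr
  by_contra hne
  have h2 := eq_one_of_germRel H hO hfree hD hp2 hp3 hr hne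
  have h3 := hr.smul_eq
  rw [h2, one_smul] at h3
  exact hne (hp1 h3)

theorem exists_lt_of_not_isDiscreteAt [T2Space M] (H : IsImmersedOn E G γ I) {q : ℝ}
    (hq : ¬ IsDiscreteAt G γ I q) {η : ℝ} (hη : 0 < η) :
    ∃ (h : G) (x y : ℝ), GermRel γ I h x y ∧ x < y ∧ q - η < x ∧ y < q + η := by
  have hb : Ioo (q - η) (q + η) ×ˢ Ioo (q - η) (q + η) ∈ 𝓝 (q, q) :=
    prod_mem_nhds (Ioo_mem_nhds (by linarith) (by linarith))
      (Ioo_mem_nhds (by linarith) (by linarith))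
  obtain ⟨p, hp, hpb⟩ := ((not_eventually.1 hq).and_eventually hb).exists
  push Not at hp
  obtain ⟨h, hr, hne⟩ := hp
  rcases lt_or_gt_of_ne hne with hlt | hlt
  · exact ⟨h, _, _, hr, hlt, hpb.1.1, hpb.2.2⟩
  · exact ⟨h⁻¹, _, _, hr.symm H, hlt, hpb.2.1, hpb.1.2⟩

theorem not_isSatedAt_of_accumulation (H : IsImmersedOn E G γ I) {q c₁ c₂ : ℝ} (hq : q ∈ I)
    (h12 : γ c₁ ≠ γ c₂) (h1 : γ c₁ ≠ γ q) (h2 : γ c₂ ≠ γ q)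
    (hacc : ∀ η > 0, ∃ (k : G) (u₁ u₂ : ℝ), k • γ c₁ = γ u₁ ∧ k • γ c₂ = γ u₂ ∧
      |u₁ - q| < η ∧ |u₂ - q| < η) : ¬ IsSatedAt G (γ q) := by
  choose k u₁ u₂ hk₁ hk₂ hu₁ hu₂ using fun n : ℕ =>
    hacc (1 / ((n : ℝ) + 1)) Nat.one_div_pos_of_nat
  have key : ∀ u : ℕ → ℝ, (∀ n, |u n - q| < 1 / ((n : ℝ) + 1)) →
      Tendsto (fun n => γ (u n)) atTop (𝓝 (γ q)) := by
    intro u hu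
    refine (H.immersedAt hq).continuousAt.tendsto.comp ?_
    rw [tendsto_iff_dist_tendsto_zero]
    exact squeeze_zero (fun _ => dist_nonneg) (fun n => (hu n).le)
      tendsto_one_div_add_atTop_nhds_zero_nat
  refine fun hs => hs ⟨γ c₁, γ c₂, h12, h1, h2, k, ?_, ?_⟩
  · simpa only [hk₁] using key u₁ hu₁
  · simpa only [hk₂] using key u₂ hu₂

theorem exists_injOn_Ioo (H : IsImmersedOn E G γ I) {q : ℝ} (hq : q ∈ I) :
    ∃ ε > 0, Ioo (q - ε) (q + ε) ⊆ I ∧ InjOn γ (Ioo (q - ε) (q + ε)) := by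
  have h1 := (H.immersedAt hq).eventually_injective
  rw [nhds_prod_eq] at h1
  obtain ⟨V, hV, hinj⟩ := (eventually_prod_self_iff (r := fun a b => γ a = γ b → a = b)).1 h1
  obtain ⟨ε, hε, hb⟩ := Metric.mem_nhds_iff.1 (inter_mem hV (H.isOpen.mem_nhds hq))
  rw [Real.ball_eq_Ioo] at hb
  exact ⟨ε, hε, fun z hz => (hb hz).2, fun a ha b hb' => hinj _ (hb ha).1 _ (hb hb').1⟩

/-- Fix `c₁ < c₂` slightly to the right of `q`. If `q` is not discrete, there are shifts with `x`
and `f x` arbitrarily close to `q`. The inverse shift is defined at both `c₁` and `c₂` and must move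
each of them to the left as far as `q`, since otherwise `q` would be related to a discrete point. So
`h⁻¹` brings both points close to `γ q`, contradicting satedness. -/
theorem isDiscreteAt_of_right [T2Space M] (H : IsImmersedOn E G γ I)
    (hfree : ∀ (g : G) (x : M), g • x = x → g = 1) (hsated : ∀ x : M, IsSatedAt G x)
    {q c : ℝ} (hq : q ∈ I) (hqc : q < c) (hgood : ∀ z ∈ Ioo q c, IsDiscreteAt G γ I z) :
    IsDiscreteAt G γ I q := by
  by_contra hbad
  obtain ⟨ε, hε, hεI, hinj⟩ := exists_injOn_Ioo H hq
  obtain ⟨c₂, hc₂, hc₂'⟩ := exists_between (lt_min hqc (show q < q + ε by linarith))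
  obtain ⟨c₁, hc₁, hc₁'⟩ := exists_between hc₂
  rw [lt_min_iff] at hc₂'
  have hm : ∀ z, q ≤ z → z ≤ c₂ → z ∈ Ioo (q - ε) (q + ε) := fun z h1 h2 =>
    ⟨by linarith, by linarith [hc₂'.2]⟩
  have hqm := hm q le_rfl hc₂.le
  have hm1 := hm c₁ hc₁.le hc₁'.le
  have hm2 := hm c₂ hc₂.le le_rfl
  refine not_isSatedAt_of_accumulation (G := G) H hq (fun h => hc₁'.ne (hinj hm1 hm2 h))
    (fun h => hc₁.ne' (hinj hm1 hqm h)) (fun h => hc₂.ne' (hinj hm2 hqm h)) (fun η hη => ?_)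
    (hsated _)
  obtain ⟨h, x, y, hr, hxy, hx, hy⟩ :=
    exists_lt_of_not_isDiscreteAt H hbad (lt_min hη (sub_pos.2 hc₁))
  have hxη : q - η < x := by linarith [min_le_left η (c₁ - q)]
  have hyc : y < c₁ := by linarith [min_le_right η (c₁ - q)]
  obtain ⟨f, J, σ, K, hf, hxJ, rfl, hlt⟩ := hr.exists_shift H hfree hxy
  have key : ∀ z ∈ Ioo q c, z ∈ I → f x < z → h⁻¹ • γ z = γ (σ z) ∧ |σ z - q| < η := by
    intro z hz hzI hxz
    have hzK : z ∈ K := hf.upper z hzI _ (hf.mapsTo hxJ) hxz.le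
    have hxσ : x < σ z := by
      rw [← hf.strictMonoOn.lt_iff_lt hxJ (hf.mapsTo_symm hzK), hf.invOn.2 hzK]
      exact hxz
    -- If `q < σ z`, then `f q` is defined and lies in the discrete interval `(q, c)`; invariance
    -- would make `q` discrete.
    have hσq : σ z ≤ q := by
      by_contra hlt'
      push Not at hlt'
      have hqJ : q ∈ J := hf.lower q hq _ (hf.mapsTo_symm hzK) hlt'.le
      have h1 : f q < z := by
        have := hf.strictMonoOn hqJ (hf.mapsTo_symm hzK) hlt'
        rwa [hf.invOn.2 hzK] at this
      have h2 := hgood (f q) ⟨hlt q hqJ, h1.trans hz.2⟩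
      exact hbad (h2.of_germRel H ((hf.germRel hqJ).symm H))
    exact ⟨hf.smul_eq_symm hzK, by rw [abs_lt]; constructor <;> linarith⟩
  obtain ⟨h1, h1'⟩ := key c₁ ⟨hc₁, hc₁'.trans hc₂'.1⟩ (hεI hm1) hyc
  obtain ⟨h2, h2'⟩ := key c₂ ⟨hc₂, hc₂'.1⟩ (hεI hm2) (hyc.trans hc₁')
  exact ⟨h⁻¹, _, _, h1, h2, h1', h2'⟩

/-- Mirror image of `isDiscreteAt_of_right`, with the forward shift pushing `c₁` and `c₂` up to `q`.
-/
theorem isDiscreteAt_of_left [T2Space M] (H : IsImmersedOn E G γ I)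
    (hfree : ∀ (g : G) (x : M), g • x = x → g = 1) (hsated : ∀ x : M, IsSatedAt G x)
    {q c : ℝ} (hq : q ∈ I) (hcq : c < q) (hgood : ∀ z ∈ Ioo c q, IsDiscreteAt G γ I z) :
    IsDiscreteAt G γ I q := by
  by_contra hbad
  obtain ⟨ε, hε, hεI, hinj⟩ := exists_injOn_Ioo H hq
  obtain ⟨c₁, hc₁', hc₁⟩ := exists_between (max_lt hcq (show q - ε < q by linarith))
  obtain ⟨c₂, hc₂', hc₂⟩ := exists_between hc₁
  rw [max_lt_iff] at hc₁'
  have hm : ∀ z, z ≤ q → c₁ ≤ z → z ∈ Ioo (q - ε) (q + ε) := fun z h1 h2 =>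
    ⟨by linarith [hc₁'.2], by linarith⟩
  have hqm := hm q le_rfl hc₁.le
  have hm1 := hm c₁ hc₁.le le_rfl
  have hm2 := hm c₂ hc₂.le hc₂'.le
  refine not_isSatedAt_of_accumulation (G := G) H hq (fun h => hc₂'.ne (hinj hm1 hm2 h))
    (fun h => hc₁.ne (hinj hm1 hqm h)) (fun h => hc₂.ne (hinj hm2 hqm h)) (fun η hη => ?_)
    (hsated _)
  obtain ⟨h, x, y, hr, hxy, hx, hy⟩ :=
    exists_lt_of_not_isDiscreteAt H hbad (lt_min hη (sub_pos.2 hc₂))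
  have hxc : c₂ < x := by linarith [min_le_right η (q - c₂)]
  have hyη : y < q + η := by linarith [min_le_left η (q - c₂)]
  obtain ⟨f, J, σ, K, hf, hxJ, rfl, hlt⟩ := hr.exists_shift H hfree hxy
  have key : ∀ z ∈ Ioo c q, z ∈ I → z < x → h • γ z = γ (f z) ∧ |f z - q| < η := by
    intro z hz hzI hxz
    have hzJ : z ∈ J := hf.lower z hzI _ hxJ hxz.le
    have hfx : f z < f x := hf.strictMonoOn hzJ hxJ hxz
    have hfq : q ≤ f z := by
      by_contra hlt'
      push Not at hlt'
      have hqK : q ∈ K := hf.upper q hq _ (hf.mapsTo hzJ) hlt'.le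
      have h1 : z < σ q := by
        have := hf.strictMonoOn_symm (hf.mapsTo hzJ) hqK hlt'
        rwa [hf.invOn.1 hzJ] at this
      have h3 : σ q < q := by
        have := hlt _ (hf.mapsTo_symm hqK)
        rwa [hf.invOn.2 hqK] at this
      have h2 := hgood (σ q) ⟨hz.1.trans h1, h3⟩
      exact hbad (h2.of_germRel H ((hf.germRel_symm hqK).symm H))
    exact ⟨hf.smul_eq z hzJ, by rw [abs_lt]; constructor <;> linarith⟩
  obtain ⟨h1, h1'⟩ := key c₁ ⟨hc₁'.1, hc₁⟩ (hεI hm1) (hc₂'.trans hxc)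
  obtain ⟨h2, h2'⟩ := key c₂ ⟨hc₁'.1.trans hc₂', hc₂⟩ (hεI hm2) hxc
  exact ⟨h, _, _, h1, h2, h1', h2'⟩

/-- The nondiscrete points between `b` and `t₀` form a compact set; the one closest to `t₀` has
discrete points on the side facing `t₀`, so the one-sided lemmas apply to it. -/
theorem isDiscreteAt_of_mem [T2Space M] (H : IsImmersedOn E G γ I)
    (hfree : ∀ (g : G) (x : M), g • x = x → g = 1) (hsated : ∀ x : M, IsSatedAt G x)
    {t₀ : ℝ} (ht₀ : t₀ ∈ I) (hgood : IsDiscreteAt G γ I t₀) {b : ℝ} (hb : b ∈ I) :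
    IsDiscreteAt G γ I b := by
  by_contra hbad
  have hcl : IsClosed {z | ¬ IsDiscreteAt G γ I z} := isOpen_isDiscreteAt.isClosed_compl
  rcases lt_trichotomy b t₀ with hlt | rfl | hlt
  · have hcpt : IsCompact (Icc b t₀ ∩ {z | ¬ IsDiscreteAt G γ I z}) := isCompact_Icc.inter_right hcl
    obtain ⟨q, ⟨hq, hqb⟩, hmax⟩ := hcpt.exists_isGreatest ⟨b, ⟨le_rfl, hlt.le⟩, hbad⟩
    have hqt : q < t₀ := lt_of_le_of_ne hq.2 fun h => hqb (h ▸ hgood)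
    refine hqb (isDiscreteAt_of_right H hfree hsated (H.ordConnected.out hb ht₀ hq) hqt ?_)
    intro z hz
    by_contra hzb
    exact absurd (hmax ⟨⟨hq.1.trans hz.1.le, hz.2.le⟩, hzb⟩) (not_le.2 hz.1)
  · exact hbad hgood
  · have hcpt : IsCompact (Icc t₀ b ∩ {z | ¬ IsDiscreteAt G γ I z}) := isCompact_Icc.inter_right hcl
    obtain ⟨q, ⟨hq, hqb⟩, hmin⟩ := hcpt.exists_isLeast ⟨b, ⟨hlt.le, le_rfl⟩, hbad⟩
    have hqt : t₀ < q := lt_of_le_of_ne hq.1 fun h => hqb (h ▸ hgood)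
    refine hqb (isDiscreteAt_of_left H hfree hsated (H.ordConnected.out ht₀ hb hq) hqt ?_)
    intro z hz
    by_contra hzb
    exact absurd (hmin ⟨⟨hz.1.le, hz.2.le.trans hq.2⟩, hzb⟩) (not_le.2 hz.2)

theorem IsDiscreteAt.exists_isFreeInterval [T2Space M] (H : IsImmersedOn E G γ I)
    (hO : ∀ h : G, IsOpenAnalyticImmersion E (fun s => h • γ s) I)
    (hfree : ∀ (g : G) (x : M), g • x = x → g = 1) {q : ℝ} (hq : q ∈ I)
    (hd : IsDiscreteAt G γ I q) : ∃ J : Set ℝ, IsOpenInterval J ∧ q ∈ J ∧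
      IsFreeInterval E G γ I J ∧
      ∀ g : G, g ≠ 1 → (((fun s => g • γ s) '' J) ∩ (γ '' J)).Finite := by
  have hd' := hd
  unfold IsDiscreteAt at hd'
  rw [nhds_prod_eq] at hd'
  obtain ⟨V, hV, hVd⟩ := (eventually_prod_self_iff
    (r := fun a b => ∀ h : G, GermRel γ I h a b → a = b)).1 hd'
  obtain ⟨ε, hε, hb⟩ := Metric.nhds_basis_closedBall.mem_iff.1
    (inter_mem hV (H.isOpen.mem_nhds hq))
  rw [Real.closedBall_eq_Icc] at hb
  set K := Icc (q - ε) (q + ε) with hK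
  have hone : ∀ (h : G), ∀ s ∈ K, ∀ t ∈ K, GermRel γ I h s t → h = 1 := by
    intro h s hs t ht hr
    have h1 := hVd s (hb hs).1 t (hb ht).1 h hr
    have h2 := hr.smul_eq
    rw [h1] at h2
    exact hfree h _ h2
  have hJK : Ioo (q - ε) (q + ε) ⊆ K := Ioo_subset_Icc_self
  have hJI : Ioo (q - ε) (q + ε) ⊆ I := fun z hz => (hb (hJK hz)).2
  have hJo : IsOpenInterval (Ioo (q - ε) (q + ε)) := isOpenInterval_Ioo (by linarith)
  have hO1 := hO 1
  simp only [one_smul] at hO1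
  refine ⟨Ioo (q - ε) (q + ε), hJo, by constructor <;> linarith, ⟨hJo.2, hJI, ⟨hJo.2, _, γ, hJo,
    subset_rfl, fun _ _ => rfl, hO1.1.mono hJI, fun t ht => hO1.2 t (hJI ht)⟩, ?_⟩, ?_⟩
  · intro g hg t ht
    obtain ⟨s, hs, t', ht', hr⟩ := exists_germRel_of_overlap H hJI hg
    rw [hone g s (hJK (interior_subset hs)) t' (hJK (interior_subset ht')) hr, one_smul]
  · intro g hg
    by_contra hinf
    -- An infinite intersection gives infinitely many parameter pairs in the compact square, hence
    -- an accumulation point. It lies in `K ×ˢ K`, where a germ relation forces `g = 1`; this is why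
    -- `K` is closed.
    set P : Set (ℝ × ℝ) := {p | p ∈ Ioo (q - ε) (q + ε) ×ˢ Ioo (q - ε) (q + ε) ∧
      g • γ p.1 = γ p.2} with hP
    have hPinf : P.Infinite := by
      intro hfin
      refine hinf ((hfin.image fun p => γ p.2).subset ?_)
      rintro _ ⟨⟨s, hs, rfl⟩, t, ht, hst⟩
      exact ⟨(s, t), ⟨⟨hs, ht⟩, hst.symm⟩, hst⟩
    have hPK : P ⊆ K ×ˢ K := fun p hp => ⟨hJK hp.1.1, hJK hp.1.2⟩
    obtain ⟨⟨s₀, t₀⟩, hst, hacc⟩ :=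
      hPinf.exists_accPt_of_subset_isCompact (isCompact_Icc.prod isCompact_Icc) hPK
    refine hg (hone g s₀ hst.1 t₀ hst.2 ?_)
    have hs₀ : s₀ ∈ I := (hb hst.1).2
    have ht₀ : t₀ ∈ I := (hb hst.2).2
    have hne : (𝓝[≠] (s₀, t₀) ⊓ 𝓟 P).NeBot := hacc
    have hle : 𝓝[≠] (s₀, t₀) ⊓ 𝓟 P ≤ 𝓝 (s₀, t₀) := inf_le_left.trans nhdsWithin_le_nhds
    have hfst : Tendsto (fun p : ℝ × ℝ => p.1) (𝓝[≠] (s₀, t₀) ⊓ 𝓟 P) (𝓝 s₀) :=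
      (continuous_fst.tendsto (s₀, t₀)).mono_left hle
    have hsnd : Tendsto (fun p : ℝ × ℝ => p.2) (𝓝[≠] (s₀, t₀) ⊓ 𝓟 P) (𝓝 t₀) :=
      (continuous_snd.tendsto (s₀, t₀)).mono_left hle
    have hPev : ∀ᶠ p in 𝓝[≠] (s₀, t₀) ⊓ 𝓟 P, g • γ p.1 = γ p.2 := by
      have : P ∈ 𝓝[≠] (s₀, t₀) ⊓ 𝓟 P := mem_inf_of_right (mem_principal_self P)
      filter_upwards [this] with p hp using hp.2
    refine H.germRel_of_tendsto (l := 𝓝[≠] (s₀, t₀) ⊓ 𝓟 P) hs₀ ht₀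
      (tendsto_nhdsWithin_iff.2 ⟨hfst, ?_⟩) hsnd hPev
    have hval : g • γ s₀ = γ t₀ :=
      tendsto_nhds_unique_of_eventuallyEq
        ((H.smul_immersedAt g s₀ hs₀).continuousAt.tendsto.comp hfst)
        ((H.immersedAt ht₀).continuousAt.tendsto.comp hsnd) hPev
    have hinj := (hsnd.prodMk_nhds (tendsto_const_nhds (x := t₀))).eventually
      (H.immersedAt ht₀).eventually_injective
    have hne' : {(s₀, t₀)}ᶜ ∈ 𝓝[≠] (s₀, t₀) ⊓ 𝓟 P := mem_inf_of_left self_mem_nhdsWithin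
    -- Pairs close to `(s₀, t₀)` but different from it differ already in the first coordinate: `p.1
    -- = s₀` would force `γ p.2 = γ t₀`, hence `p.2 = t₀`.
    filter_upwards [hPev, hinj, hne'] with p h1 h2 h3 h4
    have h4' : p.1 = s₀ := h4
    refine h3 (Prod.ext h4' (h2 ?_))
    rw [← h1, h4', hval]

end Discreteness

/-! ### Shapes of intervals and reparametrizations -/

section Intervals

theorem isInterval_of_lt {D : Set ℝ} (hD : D.OrdConnected) {a b : ℝ} (ha : a ∈ D) (hb : b ∈ D)
    (hab : a < b) : IsInterval D :=
  ⟨⟨⟨a, ha⟩, hD.isPreconnected⟩, (nonempty_Ioo.2 hab).mono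
    (isOpen_Ioo.subset_interior_iff.2 (Ioo_subset_Icc_self.trans (hD.out ha hb)))⟩

theorem inter_Ici_eq_Ico {J : Set ℝ} (hJ : IsOpen J) (hc : J.OrdConnected) {x : ℝ} (hx : x ∈ J)
    (hb : BddAbove J) : J ∩ Ici x = Ico x (sSup J) := by
  ext z
  constructor
  · rintro ⟨hz, hxz⟩
    exact ⟨hxz, lt_of_le_of_ne (le_csSup hb hz) fun h => csSup_notMem_of_isOpen hJ hb (h ▸ hz)⟩
  · rintro ⟨hxz, hz⟩
    obtain ⟨w, hw, hzw⟩ := exists_lt_of_lt_csSup ⟨x, hx⟩ hz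
    exact ⟨hc.out hx hw ⟨hxz, hzw.le⟩, hxz⟩

theorem inter_Iic_eq_Ioc {J : Set ℝ} (hJ : IsOpen J) (hc : J.OrdConnected) {x : ℝ} (hx : x ∈ J)
    (hb : BddBelow J) : J ∩ Iic x = Ioc (sInf J) x := by
  ext z
  constructor
  · rintro ⟨hz, hxz⟩
    exact ⟨lt_of_le_of_ne (csInf_le hb hz) fun h => csInf_notMem_of_isOpen hJ hb (h ▸ hz), hxz⟩
  · rintro ⟨hz, hxz⟩
    obtain ⟨w, hw, hzw⟩ := exists_lt_of_csInf_lt ⟨x, hx⟩ hz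
    exact ⟨hc.out hw hx ⟨hzw.le, hxz⟩, hxz⟩

theorem lt_csSup_of_isOpen {J : Set ℝ} (hJ : IsOpen J) {x : ℝ} (hx : x ∈ J) (hb : BddAbove J) :
    x < sSup J :=
  lt_of_le_of_ne (le_csSup hb hx) fun h => csSup_notMem_of_isOpen hJ hb (h ▸ hx)

theorem csInf_lt_of_isOpen {J : Set ℝ} (hJ : IsOpen J) {x : ℝ} (hx : x ∈ J) (hb : BddBelow J) :
    sInf J < x :=
  lt_of_le_of_ne (csInf_le hb hx) fun h => csInf_notMem_of_isOpen hJ hb (h ▸ hx)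

theorem isClosedOpen_inter_Ici {I : Set ℝ} (hI : IsOpen I) (hc : I.OrdConnected) {x : ℝ}
    (hx : x ∈ I) : IsClosedOpen (I ∩ Ici x) x := by
  by_cases hb : BddAbove I
  · exact Or.inl ⟨sSup I, lt_csSup_of_isOpen hI hx hb, inter_Ici_eq_Ico hI hc hx hb⟩
  · refine Or.inr (inter_eq_right.2 fun z hz => ?_)
    obtain ⟨w, hw, hzw⟩ := not_bddAbove_iff.1 hb z
    exact hc.out hx hw ⟨hz, hzw.le⟩

theorem isOpenClosed_inter_Iic {I : Set ℝ} (hI : IsOpen I) (hc : I.OrdConnected) {x : ℝ}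
    (hx : x ∈ I) : IsOpenClosed (I ∩ Iic x) x := by
  by_cases hb : BddBelow I
  · exact Or.inl ⟨sInf I, csInf_lt_of_isOpen hI hx hb, inter_Iic_eq_Ioc hI hc hx hb⟩
  · refine Or.inr (inter_eq_right.2 fun z hz => ?_)
    obtain ⟨w, hw, hzw⟩ := not_bddBelow_iff.1 hb z
    exact hc.out hw hx ⟨hzw.le, hz⟩

theorem reparamAt_of_diffeo {M : Type*} {γ₁ γ₂ : ℝ → M} {f σ : ℝ → ℝ} {U V D D' : Set ℝ}
    (hU : IsOpen U) (hUc : U.OrdConnected) (hV : IsOpen V) (hVc : V.OrdConnected)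
    (hf : AnalyticOnNhd ℝ f U) (hσ : AnalyticOnNhd ℝ σ V) (hfm : MapsTo f U V)
    (hσm : MapsTo σ V U) (hinv : InvOn σ f U V) (he : ∀ z ∈ U, γ₁ z = γ₂ (f z))
    (hD : IsInterval D) (hD' : IsInterval D') (hDU : D ⊆ U) (hfD : f '' D = D') {t : ℝ}
    (ht : t ∈ D) : ReparamAt γ₁ D t γ₂ D' (f t) := by
  have hDV : D' ⊆ V := hfD ▸ (hfm.mono_left hDU).image_subset
  refine ⟨ht, hfD ▸ mem_image_of_mem f ht, f, ⟨hD, hD', ?_, U, V, f, ?_, ?_, hDU, hDV,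
    ⟨hf, hfm, σ, hσ, hσm, hinv⟩, fun _ _ => rfl⟩, rfl, fun s hs => he s (hDU hs)⟩
  · exact hfD ▸ (hinv.1.injOn.mono hDU).bijOn_image
  · exact IsOpenInterval.of_ordConnected hU hUc ⟨t, hDU ht⟩
  · exact IsOpenInterval.of_ordConnected hV hVc ⟨f t, hfm (hDU ht)⟩

end Intervals

/-! ### Pieces of a decomposition from iterated shifts -/

section Positivity

variable {E : Type*} [NormedAddCommGroup E] [NormedSpace ℝ E]
variable {G : Type*} [Group G]
variable {M : Type*} [TopologicalSpace M] [ChartedSpace E M] [MulAction G M]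
variable {γ : ℝ → M} {I : Set ℝ}

namespace IsShift

variable {h : G} {f σ : ℝ → ℝ} {J K : Set ℝ}

theorem image_eq (s : IsShift γ I h f J σ K) {D D' : Set ℝ} (hD' : D' ⊆ K)
    (h1 : MapsTo f D D') (h2 : MapsTo σ D' D) : f '' D = D' :=
  Subset.antisymm h1.image_subset fun w hw => ⟨σ w, h2 hw, s.invOn.2 (hD' hw)⟩

theorem image_symm_eq (s : IsShift γ I h f J σ K) {D D' : Set ℝ} (hD : D ⊆ J)
    (h1 : MapsTo f D D') (h2 : MapsTo σ D' D) : σ '' D' = D :=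
  Subset.antisymm h2.image_subset fun w hw => ⟨f w, h1 hw, s.invOn.1 (hD hw)⟩

theorem le_symm_iff (s : IsShift γ I h f J σ K) {x y : ℝ} (hx : x ∈ J) (hy : y ∈ K) :
    x ≤ σ y ↔ f x ≤ y := by
  rw [← s.strictMonoOn.le_iff_le hx (s.mapsTo_symm hy), s.invOn.2 hy]

theorem symm_le_iff (s : IsShift γ I h f J σ K) {x y : ℝ} (hx : x ∈ J) (hy : y ∈ K) :
    σ y ≤ x ↔ y ≤ f x := by
  rw [← s.strictMonoOn.le_iff_le (s.mapsTo_symm hy) hx, s.invOn.2 hy]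

theorem reparamAt (s : IsShift γ I h f J σ K) (hI : I.OrdConnected) {D D' : Set ℝ}
    (hD : IsInterval D) (hD' : IsInterval D') (hDJ : D ⊆ J) (hD'K : D' ⊆ K)
    (h1 : MapsTo f D D') (h2 : MapsTo σ D' D) {t : ℝ} (ht : t ∈ D) :
    ReparamAt (fun z => h • γ z) D t γ D' (f t) :=
  reparamAt_of_diffeo s.isOpen_left (s.ordConnected_left hI) s.isOpen_right
    (s.ordConnected_right hI) s.analytic s.analytic_symm s.mapsTo s.mapsTo_symm s.invOn s.smul_eq
    hD hD' hDJ (s.image_eq hD'K h1 h2) ht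

theorem reparamAt_symm (s : IsShift γ I h f J σ K) (hI : I.OrdConnected) {D D' : Set ℝ}
    (hD : IsInterval D) (hD' : IsInterval D') (hDJ : D ⊆ J) (hD'K : D' ⊆ K)
    (h1 : MapsTo f D D') (h2 : MapsTo σ D' D) {t : ℝ} (ht : t ∈ D') :
    ReparamAt (fun z => h⁻¹ • γ z) D' t γ D (σ t) :=
  reparamAt_of_diffeo s.isOpen_right (s.ordConnected_right hI) s.isOpen_left
    (s.ordConnected_left hI) s.analytic_symm s.analytic s.mapsTo_symm s.mapsTo s.invOn.symm
    (fun z hz => s.smul_eq_symm (z := z) hz) hD' hD hD'K (s.image_symm_eq hDJ h1 h2) ht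

theorem isInterval_Icc {p q : ℝ} (hpq : p < q) : IsInterval (Icc p q) :=
  isInterval_of_lt ordConnected_Icc (left_mem_Icc.2 hpq.le) (right_mem_Icc.2 hpq.le) hpq

theorem mapsTo_Icc (s : IsShift γ I h f J σ K) {p q : ℝ} (hIJ : Icc p q ⊆ J) (hp : p ∈ J)
    (hq : q ∈ J) : MapsTo f (Icc p q) (Icc (f p) (f q)) := fun _ hz =>
  ⟨s.strictMonoOn.monotoneOn hp (hIJ hz) hz.1, s.strictMonoOn.monotoneOn (hIJ hz) hq hz.2⟩

theorem mapsTo_symm_Icc (s : IsShift γ I h f J σ K) {p q : ℝ} (hIK : Icc (f p) (f q) ⊆ K)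
    (hp : p ∈ J) (hq : q ∈ J) : MapsTo σ (Icc (f p) (f q)) (Icc p q) := fun _ hz =>
  ⟨(s.le_symm_iff hp (hIK hz)).2 hz.1, (s.symm_le_iff hq (hIK hz)).2 hz.2⟩

theorem reparamPos_Icc (s : IsShift γ I h f J σ K) (hI : I.OrdConnected) {p q : ℝ} (hp : p ∈ J)
    (hq : q ∈ J) (hpq : p < q) : ReparamPos (fun z => h • γ z) p q γ (Icc (f p) (f q)) := by
  have hpq' := s.strictMonoOn hp hq hpq
  have hJ := (s.ordConnected_left hI).out hp hq
  have hK := (s.ordConnected_right hI).out (s.mapsTo hp) (s.mapsTo hq)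
  exact Or.inl ⟨_, _, hpq', rfl, s.reparamAt hI (isInterval_Icc hpq) (isInterval_Icc hpq') hJ hK
    (s.mapsTo_Icc hJ hp hq) (s.mapsTo_symm_Icc hK hp hq) (left_mem_Icc.2 hpq.le)⟩

theorem reparamPos_symm_Icc (s : IsShift γ I h f J σ K) (hI : I.OrdConnected) {p q : ℝ}
    (hp : p ∈ K) (hq : q ∈ K) (hpq : p < q) :
    ReparamPos (fun z => h⁻¹ • γ z) p q γ (Icc (σ p) (σ q)) := by
  have hpq' := s.strictMonoOn_symm hp hq hpq
  have hp' := s.mapsTo_symm hp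
  have hq' := s.mapsTo_symm hq
  have hJ := (s.ordConnected_left hI).out hp' hq'
  have hK := (s.ordConnected_right hI).out hp hq
  have h1 := s.mapsTo_Icc hJ hp' hq'
  have h2 := s.mapsTo_symm_Icc (p := σ p) (q := σ q)
  rw [s.invOn.2 hp, s.invOn.2 hq] at h1 h2
  exact Or.inl ⟨_, _, hpq', rfl, s.reparamAt_symm hI (isInterval_Icc hpq') (isInterval_Icc hpq)
    hJ hK h1 (h2 hK hp' hq') (left_mem_Icc.2 hpq.le)⟩

/-- The last piece on the right: `J` ends at or before `q`, so only `[p, sSup J)` can be moved, and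
because `K` is an upper set its image fills the rest of `I`. -/
theorem reparamPos_inter_Ici (s : IsShift γ I h f J σ K) (hIo : IsOpen I) (hI : I.OrdConnected)
    {p q : ℝ} (hp : p ∈ J) (hq : q ∉ J) (hqI : q ∈ I) :
    ReparamPos (fun z => h • γ z) p q γ (I ∩ Ici (f p)) := by
  have hle : ∀ z ∈ J, z ≤ q := fun z hz => by
    by_contra hlt
    exact hq (s.lower q hqI z hz (not_le.1 hlt).le)
  have hb : BddAbove J := ⟨q, hle⟩
  have hIco := inter_Ici_eq_Ico s.isOpen_left (s.ordConnected_left hI) hp hb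
  have hpj := lt_csSup_of_isOpen s.isOpen_left hp hb
  have hfp := s.subset_right (s.mapsTo hp)
  have hco := isClosedOpen_inter_Ici hIo hI hfp
  have hD'K : I ∩ Ici (f p) ⊆ K := fun z hz => s.upper z hz.1 _ (s.mapsTo hp) hz.2
  refine Or.inr (Or.inl ⟨f p, sSup J, hco, hpj, csSup_le ⟨p, hp⟩ hle, ?_⟩)
  rw [← hIco]
  obtain ⟨w, hw⟩ := exists_between hpj
  have hwJ : w ∈ J ∩ Ici p := hIco ▸ ⟨hw.1.le, hw.2⟩
  refine s.reparamAt hI ?_ ?_ inter_subset_left hD'K ?_ ?_ ⟨hp, mem_Ici.2 le_rfl⟩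
  · exact isInterval_of_lt ((s.ordConnected_left hI).inter ordConnected_Ici) ⟨hp, le_refl (_ : ℝ)⟩ hwJ hw.1
  · have hlt := s.strictMonoOn hp hwJ.1 hw.1
    exact isInterval_of_lt (hI.inter ordConnected_Ici) ⟨hfp, le_refl (_ : ℝ)⟩
      ⟨s.subset_right (s.mapsTo hwJ.1), hlt.le⟩ hlt
  · exact fun z hz => ⟨s.subset_right (s.mapsTo hz.1), s.strictMonoOn.monotoneOn hp hz.1 hz.2⟩
  · exact fun z hz => ⟨s.mapsTo_symm (hD'K hz), (s.le_symm_iff hp (hD'K hz)).2 hz.2⟩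

theorem reparamPos_symm_inter_Iic (s : IsShift γ I h f J σ K) (hIo : IsOpen I)
    (hI : I.OrdConnected) {p q : ℝ} (hq : q ∈ K) (hp : p ∉ K) (hpI : p ∈ I) :
    ReparamPos (fun z => h⁻¹ • γ z) p q γ (I ∩ Iic (σ q)) := by
  have hle : ∀ z ∈ K, p ≤ z := fun z hz => by
    by_contra hlt
    exact hp (s.upper p hpI z hz (not_le.1 hlt).le)
  have hb : BddBelow K := ⟨p, hle⟩
  have hIoc := inter_Iic_eq_Ioc s.isOpen_right (s.ordConnected_right hI) hq hb
  have hjq := csInf_lt_of_isOpen s.isOpen_right hq hb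
  have hq' := s.mapsTo_symm hq
  have hσq := s.subset_left hq'
  have hoc := isOpenClosed_inter_Iic hIo hI hσq
  have hDJ : I ∩ Iic (σ q) ⊆ J := fun z hz => s.lower z hz.1 _ hq' hz.2
  refine Or.inr (Or.inr ⟨σ q, sInf K, hoc, le_csInf ⟨q, hq⟩ hle, hjq, ?_⟩)
  rw [← hIoc]
  obtain ⟨w, hw⟩ := exists_between hjq
  have hwK : w ∈ K ∩ Iic q := hIoc ▸ ⟨hw.1, hw.2.le⟩
  refine s.reparamAt_symm hI ?_ ?_ hDJ inter_subset_left ?_ ?_ ⟨hq, mem_Iic.2 le_rfl⟩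
  · have hlt := s.strictMonoOn_symm hwK.1 hq hw.2
    exact isInterval_of_lt (hI.inter ordConnected_Iic)
      ⟨s.subset_left (s.mapsTo_symm hwK.1), hlt.le⟩ ⟨hσq, le_refl (_ : ℝ)⟩ hlt
  · exact isInterval_of_lt ((s.ordConnected_right hI).inter ordConnected_Iic) hwK ⟨hq, le_refl (_ : ℝ)⟩ hw.2
  · exact fun z hz => ⟨s.mapsTo (hDJ hz), (s.le_symm_iff (hDJ hz) hq).1 hz.2⟩
  · exact fun z hz => ⟨s.subset_left (s.mapsTo_symm hz.1),
      s.strictMonoOn_symm.monotoneOn hz.1 hq hz.2⟩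

end IsShift

/-- The points of `I` at which the `n`-th iterate of `f : J → ℝ` is defined. -/
def iterateDomain (I : Set ℝ) (f : ℝ → ℝ) (J : Set ℝ) (n : ℕ) : Set ℝ :=
  {z ∈ I | ∀ k < n, f^[k] z ∈ J}

theorem mem_iterateDomain_succ {I J : Set ℝ} {f : ℝ → ℝ} {n : ℕ} {z : ℝ} (hJ : J ⊆ I)
    (hf : MapsTo f J I) : z ∈ iterateDomain I f J (n + 1) ↔ z ∈ J ∧ f z ∈ iterateDomain I f J n := by
  constructor
  · rintro ⟨-, h⟩
    have h0 : z ∈ J := h 0 n.succ_pos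
    exact ⟨h0, hf h0, fun k hk => h (k + 1) (Nat.succ_lt_succ hk)⟩
  · rintro ⟨h0, -, h⟩
    refine ⟨hJ h0, fun k hk => ?_⟩
    cases k with
    | zero => exact h0
    | succ k => exact h k (Nat.lt_of_succ_lt_succ hk)

theorem mem_iterateDomain_succ' {I J : Set ℝ} {f : ℝ → ℝ} {n : ℕ} {z : ℝ} :
    z ∈ iterateDomain I f J (n + 1) ↔ z ∈ iterateDomain I f J n ∧ f^[n] z ∈ J := by
  constructor
  · rintro ⟨h0, h⟩
    exact ⟨⟨h0, fun k hk => h k (Nat.lt_succ_of_lt hk)⟩, h n n.lt_succ_self⟩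
  · rintro ⟨⟨h0, h⟩, h1⟩
    refine ⟨h0, fun k hk => ?_⟩
    rcases Nat.lt_succ_iff_lt_or_eq.1 hk with hk | rfl
    · exact h k hk
    · exact h1

/-- In the inductive step the domain of `f^[n + 1]` is described by its first step and that of `σ^[n
+ 1]` by its last one, matching the two domains of a composition of shifts. -/
theorem IsShift.iterate {h : G} {f σ : ℝ → ℝ} {J K : Set ℝ} (hI : IsOpen I)
    (s : IsShift γ I h f J σ K) (n : ℕ) :
    IsShift γ I (h ^ n) f^[n] (iterateDomain I f J n) σ^[n] (iterateDomain I σ K n) := by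
  induction n with
  | zero =>
    have h0 : ∀ (f : ℝ → ℝ) (J : Set ℝ), iterateDomain I f J 0 = I := fun f J => by
      simp [iterateDomain]
    rw [h0, h0, pow_zero]
    exact IsShift.refl hI
  | succ n ih =>
    have h1 : iterateDomain I f J (n + 1) = {z ∈ J | f z ∈ iterateDomain I f J n} := by
      ext z
      exact mem_iterateDomain_succ s.subset_left fun w hw => s.subset_right (s.mapsTo hw)
    have h2 : iterateDomain I σ K (n + 1) = {z ∈ iterateDomain I σ K n | σ^[n] z ∈ K} := by
      ext z
      exact mem_iterateDomain_succ'
    rw [h1, h2, pow_succ, Function.iterate_succ, Function.iterate_succ']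
    exact s.trans ih

theorem iterate_lt_iterate {f : ℝ → ℝ} {J : Set ℝ} (hlt : ∀ z ∈ J, z < f z) {x : ℝ} {m n : ℕ}
    (hmn : m < n) (hx : x ∈ iterateDomain I f J n) : f^[m] x < f^[n] x := by
  induction n, hmn using Nat.le_induction with
  | base =>
    rw [Function.iterate_succ_apply']
    exact hlt _ (hx.2 m m.lt_succ_self)
  | succ n hmn ih =>
    have h1 := mem_iterateDomain_succ'.1 hx
    refine (ih h1.1).trans ?_
    rw [Function.iterate_succ_apply']
    exact hlt _ h1.2

theorem iterate_gt_iterate {f : ℝ → ℝ} {J : Set ℝ} (hlt : ∀ z ∈ J, f z < z) {x : ℝ} {m n : ℕ}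
    (hmn : m < n) (hx : x ∈ iterateDomain I f J n) : f^[n] x < f^[m] x := by
  induction n, hmn using Nat.le_induction with
  | base =>
    rw [Function.iterate_succ_apply']
    exact hlt _ (hx.2 m m.lt_succ_self)
  | succ n hmn ih =>
    have h1 := mem_iterateDomain_succ'.1 hx
    refine lt_trans ?_ (ih h1.1)
    rw [Function.iterate_succ_apply']
    exact hlt _ h1.2

theorem exists_nat_bound {P : ℕ → Prop} (h1 : P 1) (hP : ∀ n, P (n + 1) → P n) :
    (∀ n, P n) ∨ ∃ N, 1 ≤ N ∧ ∀ n, P n ↔ n ≤ N := by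
  classical
  by_cases h : ∀ n, P n
  · exact Or.inl h
  · push Not at h
    have hanti : ∀ m n, m ≤ n → P n → P m := fun m n hmn => by
      induction n, hmn using Nat.le_induction with
      | base => exact id
      | succ n _ ih => exact fun h => ih (hP n h)
    have hspec := Nat.find_spec h
    set N := Nat.find h with hN
    have h2 : 1 < N := by
      by_contra hlt
      exact hspec (hanti _ _ (not_lt.1 hlt) h1)
    refine Or.inr ⟨N - 1, by omega, fun n => ⟨fun hn => ?_, fun hn => ?_⟩⟩
    · by_contra hlt
      exact hspec (hanti N n (by omega) hn)
    · by_contra hn'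
      have := Nat.find_min' h hn'
      omega

/-- Supplies the upper end of the index set when `P m` says that the `m`-th iterate is defined; the
last clause identifies the final index as the one whose successor fails. -/
theorem exists_withTop_bound {P : ℕ → Prop} (h1 : P 1) (hP : ∀ n, P (n + 1) → P n) :
    ∃ hi : WithTop ℤ, ((0 : ℤ) : WithTop ℤ) < hi ∧ (∀ m : ℕ, ((m : ℤ) : WithTop ℤ) ≤ hi ↔ P m) ∧
      ∀ m : ℕ, P m → (hi = ((m : ℤ) : WithTop ℤ) ↔ ¬ P (m + 1)) := by
  rcases exists_nat_bound h1 hP with h | ⟨N, hN, h⟩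
  · exact ⟨⊤, WithTop.coe_lt_top _, fun m => by simp [h m], fun m _ => by simp [h (m + 1)]⟩
  · refine ⟨((N : ℤ) : WithTop ℤ), ?_, fun m => ?_, fun m hm => ?_⟩
    · rw [WithTop.coe_lt_coe]; omega
    · rw [WithTop.coe_le_coe, h]; omega
    · rw [h] at hm
      rw [WithTop.coe_inj, h]; omega

theorem exists_withBot_bound {P : ℕ → Prop} (h1 : P 1) (hP : ∀ n, P (n + 1) → P n) :
    ∃ lo : WithBot ℤ, lo < ((0 : ℤ) : WithBot ℤ) ∧
      (∀ m : ℕ, lo ≤ ((-(m : ℤ) : ℤ) : WithBot ℤ) ↔ P m) ∧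
      ∀ m : ℕ, P m → (lo = ((-(m : ℤ) : ℤ) : WithBot ℤ) ↔ ¬ P (m + 1)) := by
  rcases exists_nat_bound h1 hP with h | ⟨N, hN, h⟩
  · exact ⟨⊥, WithBot.bot_lt_coe _, fun m => by simp [h m], fun m _ => by
      simp [h (m + 1)]⟩
  · refine ⟨((-(N : ℤ) : ℤ) : WithBot ℤ), ?_, fun m => ?_, fun m hm => ?_⟩
    · rw [WithBot.coe_lt_coe]; omega
    · rw [WithBot.coe_le_coe, h]; omega
    · rw [h] at hm
      rw [WithBot.coe_inj, h]; omega

end Positivity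

/-! ### The dichotomy: free segment or positive curve -/

section MainProof

variable {E : Type*} [NormedAddCommGroup E] [NormedSpace ℝ E]
variable {G : Type*} [Group G]
variable {M : Type*} [TopologicalSpace M] [ChartedSpace E M] [MulAction G M]
variable {γ : ℝ → M} {I : Set ℝ}

/-- A shift mapping the left end of a free interval to its right end induces a decomposition. -/
theorem IsShift.exists_decomposition (hIo : IsOpen I) (hI : I.OrdConnected)
    (hfree : ∀ (g : G) (x : M), g • x = x → g = 1) {h : G} (hh : h ≠ 1) {f σ : ℝ → ℝ}
    {J K : Set ℝ} (s : IsShift γ I h f J σ K) (hlt : ∀ z ∈ J, z < f z) {p : ℝ} (hp : p ∈ J)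
    (hA : IsFreeInterval E G γ I (Icc p (f p))) :
    ∃ (d : Decomposition I) (g : ℤ → G), IsDecompositionOf E G γ I p (f p) d g ∧
      ReparamPos (fun t => g 1 • γ t) p (f p) γ (d.piece 1) ∧
      ReparamPos (fun t => g (-1) • γ t) p (f p) γ (d.piece (-1)) := by
  obtain ⟨q, hq⟩ : ∃ q, f p = q := ⟨_, rfl⟩
  rw [hq] at hA ⊢
  have hpI := s.subset_left hp
  have hqK : q ∈ K := hq ▸ s.mapsTo hp
  have hσq : σ q = p := by rw [← hq, s.invOn.1 hp]
  have hpq : p < q := hq ▸ hlt p hp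
  have hqI := s.subset_right hqK
  have hgt : ∀ z ∈ K, σ z < z := fun z hz => by
    have := hlt _ (s.mapsTo_symm hz)
    rwa [s.invOn.2 hz] at this
  have hfI : MapsTo f J I := fun z hz => s.subset_right (s.mapsTo hz)
  have hσI : MapsTo σ K I := fun z hz => s.subset_left (s.mapsTo_symm hz)
  set A := iterateDomain I f J with hAdef
  set B := iterateDomain I σ K with hBdef
  have sn : ∀ n, IsShift γ I (h ^ n) f^[n] (A n) σ^[n] (B n) := s.iterate hIo
  have hA1 : p ∈ A 1 := ⟨hpI, fun k hk => by
    obtain rfl : k = 0 := by omega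
    exact hp⟩
  have hB1 : q ∈ B 1 := ⟨hqI, fun k hk => by
    obtain rfl : k = 0 := by omega
    exact hqK⟩
  -- Since `f p = q`, the next division point exists exactly when the current iterate is defined on
  -- all of `[p, q]`. This decides between a compact piece and a final half-open one.
  have hAs : ∀ n, p ∈ A (n + 1) ↔ q ∈ A n := fun n => by
    rw [hAdef, mem_iterateDomain_succ s.subset_left hfI, hq]
    exact and_iff_right hp
  have hBs : ∀ n, q ∈ B (n + 1) ↔ p ∈ B n := fun n => by
    rw [hBdef, mem_iterateDomain_succ s.subset_right hσI, hσq]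
    exact and_iff_right hqK
  obtain ⟨hi, hi0, hile, hieq⟩ := exists_withTop_bound (P := fun n => p ∈ A n) hA1
    fun n hn => (mem_iterateDomain_succ'.1 hn).1
  obtain ⟨lo, lo0, lole, loeq⟩ := exists_withBot_bound (P := fun n => q ∈ B n) hB1
    fun n hn => (mem_iterateDomain_succ'.1 hn).1
  -- The index `0` is omitted, so the two sides start from different ends: `a 1 = f p = q` and `a
  -- (-1) = σ q = p`.
  set a : ℤ → ℝ := fun n => if 0 < n then f^[n.toNat] p else σ^[(-n).toNat] q with ha
  have hapos : ∀ m : ℕ, 0 < m → a m = f^[m] p := fun m hm => by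
    simp only [ha]
    rw [if_pos (by omega), Int.toNat_natCast]
  have haneg : ∀ m : ℕ, a (-(m : ℤ)) = σ^[m] q := fun m => by
    simp only [ha]
    rw [if_neg (by omega), neg_neg, Int.toNat_natCast]
  have hcases : ∀ n : ℤ, n ≠ 0 → (∃ m : ℕ, 0 < m ∧ n = m) ∨ ∃ m : ℕ, 0 < m ∧ n = -(m : ℤ) := by
    intro n hn
    rcases lt_or_gt_of_ne hn with h0 | h0
    · exact Or.inr ⟨n.natAbs, by omega, by omega⟩
    · exact Or.inl ⟨n.natAbs, by omega, by omega⟩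
  let d : Decomposition I :=
    { lo := lo
      hi := hi
      lo_neg := lo0
      hi_pos := hi0
      a := a
      a_mem := by
        intro n hn hnlo hnhi
        rw [hIo.interior_eq]
        rcases hcases n hn with ⟨m, hm, rfl⟩ | ⟨m, hm, rfl⟩
        · rw [hapos m hm]
          exact (sn m).subset_right ((sn m).mapsTo ((hile m).1 hnhi))
        · rw [haneg m]
          exact (sn m).subset_left ((sn m).mapsTo_symm ((lole m).1 hnlo))
      a_lt := by
        intro i j hi' hj' hlo' hhi' hij
        rcases hcases i hi' with ⟨m, hm, rfl⟩ | ⟨m, hm, rfl⟩ <;>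
          rcases hcases j hj' with ⟨n, hn, rfl⟩ | ⟨n, hn, rfl⟩
        · rw [hapos m hm, hapos n hn]
          exact iterate_lt_iterate hlt (by omega) ((hile n).1 hhi')
        · omega
        · rw [haneg m, hapos n hn]
          have h1 : σ^[m] q < σ^[0] q := iterate_gt_iterate hgt hm ((lole m).1 hlo')
          have h2 : q ≤ f^[n] p := by
            rcases Nat.lt_or_eq_of_le (show 1 ≤ n from hn) with h1n | rfl
            · have := iterate_lt_iterate hlt h1n ((hile n).1 hhi')
              rw [Function.iterate_one, hq] at this
              exact this.le
            · rw [Function.iterate_one, hq]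
          exact h1.trans_le h2
        · rw [haneg m, haneg n]
          exact iterate_gt_iterate hgt (by omega) ((lole m).1 hlo') }
  have hpos : ∀ m : ℕ, 0 < m → p ∈ A m →
      ReparamPos (fun t => h ^ (m : ℤ) • γ t) p q γ (d.piece m) := by
    intro m hm hpm
    rw [zpow_natCast]
    have h0 : ¬ ((m : ℤ) = 0) := by omega
    have h1 : ¬ ((m : ℤ) < 0) := by omega
    unfold Decomposition.piece
    rw [if_neg h0, if_neg h1]
    by_cases hqm : q ∈ A m
    · have h2 : d.hi ≠ ((m : ℤ) : WithTop ℤ) := fun h3 => (hieq m hpm).1 h3 ((hAs m).2 hqm)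
      have h4 : d.a (m + 1) = f^[m] q := by
        have := hapos (m + 1) m.succ_pos
        rw [Function.iterate_succ_apply, hq] at this
        exact_mod_cast this
      rw [if_neg h2, h4, show d.a m = f^[m] p from hapos m hm]
      exact (sn m).reparamPos_Icc hI hpm hqm hpq
    · have h2 : d.hi = ((m : ℤ) : WithTop ℤ) := (hieq m hpm).2 fun h3 => hqm ((hAs m).1 h3)
      rw [if_pos h2, show d.a m = f^[m] p from hapos m hm]
      exact (sn m).reparamPos_inter_Ici hIo hI hpm hqm hqI
  have hneg : ∀ m : ℕ, 0 < m → q ∈ B m →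
      ReparamPos (fun t => h ^ (-(m : ℤ)) • γ t) p q γ (d.piece (-(m : ℤ))) := by
    intro m hm hqm
    rw [zpow_neg, zpow_natCast]
    have h0 : ¬ (-(m : ℤ) = 0) := by omega
    have h1 : -(m : ℤ) < 0 := by omega
    unfold Decomposition.piece
    rw [if_neg h0, if_pos h1]
    by_cases hpm : p ∈ B m
    · have h2 : d.lo ≠ ((-(m : ℤ) : ℤ) : WithBot ℤ) := fun h3 =>
        (loeq m hqm).1 h3 ((hBs m).2 hpm)
      have h4 : d.a (-(m : ℤ) - 1) = σ^[m] p := by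
        have := haneg (m + 1)
        rw [Function.iterate_succ_apply, hσq] at this
        rw [← this]
        change a _ = a _
        congr 1
        push_cast
        ring
      rw [if_neg h2, h4, show d.a (-(m : ℤ)) = σ^[m] q from haneg m]
      exact (sn m).reparamPos_symm_Icc hI hpm hqm hpq
    · have h2 : d.lo = ((-(m : ℤ) : ℤ) : WithBot ℤ) :=
        (loeq m hqm).2 fun h3 => hpm ((hBs m).1 h3)
      rw [if_pos h2, show d.a (-(m : ℤ)) = σ^[m] q from haneg m]
      exact (sn m).reparamPos_symm_inter_Iic hIo hI hqm hpm hpI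
  have hstab : ∀ k : G, k ∈ curveStabilizer G γ I → k = 1 := by
    intro k hk
    simp only [curveStabilizer, Subgroup.mem_iInf, MulAction.mem_stabilizer_iff] at hk
    exact hfree k _ (hk p hpI)
  refine ⟨d, fun n => h ^ n, ⟨hpq, hA, ?_, ?_, ?_, ?_⟩, ?_, ?_⟩
  · unfold Decomposition.piece
    have h1 : d.a 1 = q := by
      have := hapos 1 one_pos
      rw [Function.iterate_one, hq] at this
      exact_mod_cast this
    have h2 : d.a (-1) = p := by
      have := haneg 1
      rw [Function.iterate_one, hσq] at this
      exact_mod_cast this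
    rw [if_pos rfl, h1, h2]
  · exact fun h1 => hh (by simpa using hstab _ h1)
  · exact fun h1 => hh (by simpa using hstab _ h1)
  · rintro n ⟨hn, hnlo, hnhi⟩
    rcases hcases n hn with ⟨m, hm, rfl⟩ | ⟨m, hm, rfl⟩
    · exact Or.inl (hpos m hm ((hile m).1 hnhi))
    · exact Or.inl (hneg m hm ((lole m).1 hnlo))
  · simpa only [Nat.cast_one] using hpos 1 one_pos hA1
  · simpa only [Nat.cast_one] using hneg 1 one_pos hB1

/-- If the infimum of the parameters related to `p` were not attained, two of them, `y₂ < y₁`, would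
lie arbitrarily close to it; composing through `p` relates `y₂` to `y₁` and contradicts discreteness
at the infimum. -/
theorem exists_least_germRel [T2Space M] (H : IsImmersedOn E G γ I)
    (hdisc : ∀ q ∈ I, IsDiscreteAt G γ I q) {h : G} {p t : ℝ} (hh : h ≠ 1)
    (hr : GermRel γ I h p t) (hpt : p < t) :
    ∃ q, p < q ∧ (∃ k : G, k ≠ 1 ∧ GermRel γ I k p q) ∧
      ∀ (k : G) (y : ℝ), k ≠ 1 → GermRel γ I k p y → p < y → q ≤ y := by
  set T : Set ℝ := {y | p < y ∧ ∃ k : G, k ≠ 1 ∧ GermRel γ I k p y} with hT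
  have hne : T.Nonempty := ⟨t, hpt, h, hh, hr⟩
  have hb : BddBelow T := ⟨p, fun y hy => hy.1.le⟩
  suffices hmem : sInf T ∈ T from
    ⟨sInf T, hmem.1, hmem.2, fun k y hk hy hpy => csInf_le hb ⟨hpy, k, hk, hy⟩⟩
  by_contra hnot
  have hqI : sInf T ∈ I := H.ordConnected.out hr.1 hr.2.1
    ⟨le_csInf hne fun y hy => hy.1.le, csInf_le hb ⟨hpt, h, hh, hr⟩⟩
  have hd := hdisc _ hqI
  unfold IsDiscreteAt at hd
  rw [nhds_prod_eq] at hd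
  obtain ⟨V, hV, hVd⟩ := (eventually_prod_self_iff
    (r := fun a b => ∀ k : G, GermRel γ I k a b → a = b)).1 hd
  obtain ⟨ε, hε, hball⟩ := Metric.mem_nhds_iff.1 hV
  rw [Real.ball_eq_Ioo] at hball
  have hgt : ∀ y ∈ T, sInf T < y := fun y hy =>
    lt_of_le_of_ne (csInf_le hb hy) fun he => hnot (he ▸ hy)
  obtain ⟨y₁, hy₁, hlt₁⟩ := exists_lt_of_csInf_lt hne (show sInf T < sInf T + ε by linarith)
  obtain ⟨y₂, hy₂, hlt₂⟩ := exists_lt_of_csInf_lt hne (hgt y₁ hy₁)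
  have h1 := hgt y₁ hy₁
  have h2 := hgt y₂ hy₂
  obtain ⟨-, k₁, -, hk₁⟩ := hy₁
  obtain ⟨-, k₂, -, hk₂⟩ := hy₂
  have := hVd y₂ (hball ⟨by linarith, by linarith⟩) y₁ (hball ⟨by linarith, by linarith⟩) _
    ((hk₂.symm H).trans hk₁)
  exact hlt₂.ne this

theorem isFreeInterval_of_germRel [T2Space M] (H : IsImmersedOn E G γ I)
    (hO : IsOpenAnalyticImmersion E γ I) (hIi : IsOpenInterval I) {D : Set ℝ} (hD : IsInterval D)
    (hDI : D ⊆ I)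
    (h1 : ∀ (k : G), ∀ s ∈ interior D, ∀ t ∈ interior D, GermRel γ I k s t → k = 1) :
    IsFreeInterval E G γ I D := by
  refine ⟨hD, hDI, ⟨hD, I, γ, hIi, hDI, fun _ _ => rfl, hO⟩, fun g hg t _ => ?_⟩
  obtain ⟨s, hs, t', ht', hr⟩ := exists_germRel_of_overlap H hDI hg
  rw [h1 g s hs t' ht' hr, one_smul]

theorem isPositiveCurve_of_not_isFreeSegment [T2Space M] (H : IsImmersedOn E G γ I)
    (hO : ∀ h : G, IsOpenAnalyticImmersion E (fun s => h • γ s) I) (hIi : IsOpenInterval I)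
    (hfree : ∀ (g : G) (x : M), g • x = x → g = 1)
    (hdisc : ∀ q ∈ I, IsDiscreteAt G γ I q) (hnot : ¬ IsFreeSegment E G γ I) :
    IsPositiveCurve E G γ I := by
  have hO1 : IsOpenAnalyticImmersion E γ I := by simpa only [one_smul] using hO 1
  obtain ⟨h, p, t, hh, hr, hpt⟩ : ∃ (h : G) (p t : ℝ), h ≠ 1 ∧ GermRel γ I h p t ∧ p < t := by
    by_contra hcon
    push Not at hcon
    refine hnot (isFreeInterval_of_germRel H hO1 hIi hIi.2 subset_rfl fun k s _ t _ hr => ?_).2.2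
    by_contra hk
    have h1 := hcon k s t hk hr
    have h2 := hcon k⁻¹ t s (inv_ne_one.2 hk) (hr.symm H)
    have h3 := hr.smul_eq
    rw [le_antisymm h1 h2] at h3
    exact hk (hfree k _ h3)
  obtain ⟨q, hpq, ⟨k, hk, hkr⟩, hmin⟩ := exists_least_germRel H hdisc hh hr hpt
  obtain ⟨f, J, σ, K, s, hpJ, rfl, hlt⟩ := hkr.exists_shift H hfree hpq
  have hDI : Icc p (f p) ⊆ I := H.ordConnected.out hkr.1 hkr.2.1
  -- A nontrivial relation inside `(p, q)` continues to the left as far as `p`, because domains of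
  -- shifts are lower sets. By monotonicity it sends `p` below `y < q`, against the minimality of
  -- `q`.
  have key : ∀ (g : G) (x y : ℝ), p < x → y < f p → x < y → GermRel γ I g x y → g = 1 := by
    intro g x y hx hy hxy hg
    by_contra hg1
    obtain ⟨f', J', σ', K', s', hxJ', rfl, hlt'⟩ := hg.exists_shift H hfree hxy
    have hpJ' := s'.lower p hkr.1 x hxJ' hx.le
    have h1 := hmin g _ hg1 (s'.germRel hpJ') (hlt' p hpJ')
    have h2 := s'.strictMonoOn hpJ' hxJ' hx
    linarith
  have hA : IsFreeInterval E G γ I (Icc p (f p)) := by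
    refine isFreeInterval_of_germRel H hO1 hIi (IsShift.isInterval_Icc hpq) hDI ?_
    rw [interior_Icc]
    intro g x hx y hy hg
    rcases lt_trichotomy x y with hxy | rfl | hxy
    · exact key g x y hx.1 hy.2 hxy hg
    · exact hfree g _ hg.smul_eq
    · exact inv_eq_one.1 (key _ y x hy.1 hx.2 hxy (hg.symm H))
  refine ⟨p, f p, ⟨hA, fun A' hA' hss => ?_⟩,
    s.exists_decomposition H.isOpen H.ordConnected hfree hk hlt hpJ hA⟩
  have hAc : A'.OrdConnected := hA'.1.1.isPreconnected.ordConnected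
  obtain ⟨z, hz, hzn⟩ := exists_of_ssubset hss
  have hpA : p ∈ A' := hss.1 (left_mem_Icc.2 hpq.le)
  have hqA : f p ∈ A' := hss.1 (right_mem_Icc.2 hpq.le)
  have hnhds : ∀ {a b w : ℝ}, a ∈ A' → b ∈ A' → a < w → w < b → A' ∈ 𝓝 w :=
    fun ha hb haw hwb => mem_of_superset (Icc_mem_nhds haw hwb) (hAc.out ha hb)
  -- A larger free interval contains a neighbourhood of `p` or of `q`. In the first case `σ` moves a
  -- point just left of `q` to one just left of `p`; in the second `f` moves a point just right of
  -- `p` to one just right of `q`. Either way the nontrivial `k` relates two distinct interior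
  -- points of a free interval.
  rcases lt_or_ge z p with hzp | hpz
  · have hq : f p ∈ K := s.mapsTo hpJ
    have hσ : Tendsto σ (𝓝[<] (f p)) (𝓝 p) := by
      have := (s.analytic_symm _ hq).continuousAt.tendsto
      rw [s.invOn.1 hpJ] at this
      exact this.mono_left nhdsWithin_le_nhds
    obtain ⟨x, hx1, hx2, hx3⟩ := ((hσ.eventually (Ioi_mem_nhds hzp)).and
      ((eventually_mem_set.2 (Ioo_mem_nhdsLT hpq)).and (nhdsWithin_le_nhds (s.isOpen_right.mem_nhds hq)))).exists
    have hσx : σ x < p := by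
      have := s.strictMonoOn_symm hx3 hq hx2.2
      rwa [s.invOn.1 hpJ] at this
    have := eq_one_of_germRel H hO hfree hA'.2.2 (hnhds hpA hqA hx2.1 hx2.2)
      (hnhds hz hpA hx1 hσx) (s.germRel_symm hx3) (hσx.trans hx2.1).ne'
    exact hk (inv_eq_one.1 this)
  · have hqz : f p < z := by
      by_contra hle
      exact hzn ⟨hpz, not_lt.1 hle⟩
    have hf : Tendsto f (𝓝[>] p) (𝓝 (f p)) :=
      (s.analytic _ hpJ).continuousAt.tendsto.mono_left nhdsWithin_le_nhds
    obtain ⟨x, hx1, hx2, hx3⟩ := ((hf.eventually (Iio_mem_nhds hqz)).and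
      ((eventually_mem_set.2 (Ioo_mem_nhdsGT hpq)).and (nhdsWithin_le_nhds (s.isOpen_left.mem_nhds hpJ)))).exists
    have hfx : f p < f x := s.strictMonoOn hpJ hx3 hx2.1
    exact hk (eq_one_of_germRel H hO hfree hA'.2.2 (hnhds hpA hqA hx2.1 hx2.2)
      (hnhds hqA hz hfx hx1) (s.germRel hx3) (hx2.2.trans hfx).ne)

theorem exists_germRel_of_reparamAt {h : G} {D D' : Set ℝ} {t t' : ℝ} (hD : D ⊆ I) (hD' : D' ⊆ I)
    (hr : ReparamAt (fun s => h • γ s) D t γ D' t') : ∃ x y, GermRel γ I h x y := by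
  obtain ⟨-, -, ρ, ⟨hDi, -, hbij, U, V, ρ', -, -, hDU, -, ⟨han, -⟩, heq⟩, -, hγ⟩ := hr
  obtain ⟨x, hx⟩ := hDi.2
  have hxD := interior_subset hx
  refine ⟨x, ρ x, hD hxD, hD' (hbij.mapsTo hxD), ρ', han x (hDU hxD), heq hxD, ?_⟩
  filter_upwards [isOpen_interior.mem_nhds hx] with z hz
  rw [heq (interior_subset hz)]
  exact hγ z (interior_subset hz)

theorem Decomposition.piece_one_subset (hI : I.OrdConnected) (d : Decomposition I) :
    d.piece 1 ⊆ I := by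
  unfold Decomposition.piece
  rw [if_neg (by norm_num), if_neg (by norm_num)]
  split_ifs with h1
  · exact inter_subset_left
  -- When `1` is not the last index, `2` is an index too, so both ends of the piece lie in `I`.
  · have hlo : ∀ n : ℤ, 0 < n → d.lo ≤ (n : WithBot ℤ) := fun n hn =>
      (d.lo_neg.trans (WithBot.coe_lt_coe.2 hn)).le
    have h2 : ((2 : ℤ) : WithTop ℤ) ≤ d.hi := by
      have h0 := d.hi_pos
      generalize d.hi = e at h0 h1
      induction e using WithTop.recTopCoe with
      | top => exact le_top
      | coe e =>
        rw [WithTop.coe_lt_coe] at h0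
        have h3 : e ≠ 1 := fun h => h1 (by rw [h])
        rw [WithTop.coe_le_coe]
        omega
    have h3 : ((1 : ℤ) : WithTop ℤ) ≤ d.hi := le_trans (WithTop.coe_le_coe.2 (by norm_num)) h2
    exact hI.out (interior_subset (d.a_mem 1 one_ne_zero (hlo 1 one_pos) h3))
      (interior_subset (d.a_mem (1 + 1) (by norm_num) (hlo _ (by norm_num)) h2))

/-- The reparametrization onto the piece with index `1` yields a germ relation by `g 1`. If all of
`I` were free, this would force `g 1 = 1`, which lies in the stabilizer of the curve. -/
theorem not_isFreeSegment_of_isPositiveCurve [T2Space M] (H : IsImmersedOn E G γ I)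
    (hO : ∀ h : G, IsOpenAnalyticImmersion E (fun s => h • γ s) I)
    (hfree : ∀ (g : G) (x : M), g • x = x → g = 1)
    (hpos : IsPositiveCurve E G γ I) : ¬ IsFreeSegment E G γ I := by
  intro hI
  obtain ⟨p, q, -, d, g, ⟨-, hA, -, hg1, -, -⟩, hP, -⟩ := hpos
  have hsub := d.piece_one_subset H.ordConnected
  have hex : ∃ x y, GermRel γ I (g 1) x y := by
    rcases hP with ⟨a', b', -, -, hr⟩ | ⟨a', j, -, -, hj, hr⟩ | ⟨b', j, -, hj, -, hr⟩
    · exact exists_germRel_of_reparamAt hA.2.1 hsub hr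
    · exact exists_germRel_of_reparamAt
        ((Ico_subset_Icc_self.trans (Icc_subset_Icc_right hj)).trans hA.2.1) hsub hr
    · exact exists_germRel_of_reparamAt
        ((Ioc_subset_Icc_self.trans (Icc_subset_Icc_left hj)).trans hA.2.1) hsub hr
  obtain ⟨x, y, hr⟩ := hex
  refine hg1 ?_
  have h1 : g 1 = 1 := by
    by_cases hxy : x = y
    · subst hxy
      exact hfree _ _ hr.smul_eq
    · exact eq_one_of_germRel H hO hfree hI (H.isOpen.mem_nhds hr.1) (H.isOpen.mem_nhds hr.2.1)
        hr hxy
  rw [h1]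
  exact one_mem _

theorem IsAnalyticImmersion.isOpenAnalyticImmersion (hI : IsOpen I)
    (hγ : IsAnalyticImmersion E γ I) : IsOpenAnalyticImmersion E γ I := by
  obtain ⟨-, U, δ, -, hIU, heq, hδ, hinj⟩ := hγ
  refine ⟨(hδ.mono hIU).congr fun t ht => (heq ht).symm, fun t ht => ?_⟩
  have he : γ =ᶠ[𝓝 t] δ := by
    filter_upwards [hI.mem_nhds ht] with s hs using (heq hs).symm
  have h1 := hinj t (hIU ht)
  have h2 := he.mfderiv_eq (I := 𝓘(ℝ, ℝ)) (I' := 𝓘(ℝ, E))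
  rw [h2]
  exact h1

/-- The differential of translation by `h` is injective because that of `h⁻¹` is a left inverse. -/
theorem IsOpenAnalyticImmersion.smul [IsManifold 𝓘(ℝ, E) ω M] (hI : IsOpen I)
    (hM : ∀ g : G, ContMDiff 𝓘(ℝ, E) 𝓘(ℝ, E) ω (fun x : M => g • x))
    (hγ : IsOpenAnalyticImmersion E γ I) (h : G) :
    IsOpenAnalyticImmersion E (fun s => h • γ s) I := by
  refine ⟨(hM h).comp_contMDiffOn hγ.1, fun t ht => ?_⟩
  have hd : ∀ (g : G) (x : M), MDifferentiableAt 𝓘(ℝ, E) 𝓘(ℝ, E) (fun x : M => g • x) x :=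
    fun g x => (hM g).contMDiffAt.mdifferentiableAt (by simp)
  have hγd : MDifferentiableAt 𝓘(ℝ, ℝ) 𝓘(ℝ, E) γ t :=
    (hγ.1.contMDiffAt (hI.mem_nhds ht)).mdifferentiableAt (by simp)
  have h1 : mfderiv 𝓘(ℝ, ℝ) 𝓘(ℝ, E) (fun s => h • γ s) t
      = (mfderiv 𝓘(ℝ, E) 𝓘(ℝ, E) (fun x : M => h • x) (γ t)).comp
        (mfderiv 𝓘(ℝ, ℝ) 𝓘(ℝ, E) γ t) := mfderiv_comp t (hd h (γ t)) hγd
  have h2 : mfderiv 𝓘(ℝ, E) 𝓘(ℝ, E) ((fun x : M => h⁻¹ • x) ∘ fun x : M => h • x) (γ t)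
      = (mfderiv 𝓘(ℝ, E) 𝓘(ℝ, E) (fun x : M => h⁻¹ • x) (h • γ t)).comp
        (mfderiv 𝓘(ℝ, E) 𝓘(ℝ, E) (fun x : M => h • x) (γ t)) :=
    mfderiv_comp (γ t) (hd h⁻¹ (h • γ t)) (hd h (γ t))
  have h3 : ((fun x : M => h⁻¹ • x) ∘ fun x : M => h • x) = id := by
    ext x
    simp
  rw [h3, mfderiv_id] at h2
  have h4 : Function.Injective (mfderiv 𝓘(ℝ, E) 𝓘(ℝ, E) (fun x : M => h • x) (γ t)) := by
    intro v w hvw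
    have hv := DFunLike.congr_fun h2 v
    have hw := DFunLike.congr_fun h2 w
    have : (mfderiv 𝓘(ℝ, E) 𝓘(ℝ, E) (fun x : M => h⁻¹ • x) (h • γ t))
        (mfderiv 𝓘(ℝ, E) 𝓘(ℝ, E) (fun x : M => h • x) (γ t) v)
        = (mfderiv 𝓘(ℝ, E) 𝓘(ℝ, E) (fun x : M => h⁻¹ • x) (h • γ t))
        (mfderiv 𝓘(ℝ, E) 𝓘(ℝ, E) (fun x : M => h • x) (γ t) w) := congrArg _ hvw
    exact hv.trans (this.trans hw.symm)
  rw [h1]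
  exact h4.comp (hγ.2 t ht)

theorem IsOpenAnalyticImmersion.immersedAt [CompleteSpace E] (hI : IsOpen I)
    (hγ : IsOpenAnalyticImmersion E γ I) {t : ℝ} (ht : t ∈ I) : ImmersedAt E γ t :=
  ImmersedAt.of_contMDiffAt (hγ.1.contMDiffAt (hI.mem_nhds ht)) (hγ.2 t ht)

end MainProof

end AnalyticCurves

theorem mainTheorem10
    {E : Type*} [NormedAddCommGroup E] [NormedSpace ℝ E] [FiniteDimensional ℝ E]
    {F : Type*} [NormedAddCommGroup F] [NormedSpace ℝ F] [FiniteDimensional ℝ F]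
    {G : Type*} [TopologicalSpace G] [ChartedSpace F G] [Group G] [LieGroup 𝓘(ℝ, F) ω G]
    [T2Space G] [SecondCountableTopology G]
    {M : Type*} [TopologicalSpace M] [ChartedSpace E M] [IsManifold 𝓘(ℝ, E) ω M]
    [T2Space M] [SecondCountableTopology M]
    [MulAction G M]
    (hG : ∀ x : M, ContMDiff 𝓘(ℝ, F) 𝓘(ℝ, E) ω (fun g : G => g • x))
    (hM : ∀ g : G, ContMDiff 𝓘(ℝ, E) 𝓘(ℝ, E) ω (fun x : M => g • x))
    (hsated : ∀ x : M, AnalyticCurves.IsSatedAt G x)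
    (hfree : ∀ x : M, MulAction.stabilizer G x = ⊥)
    (γ : ℝ → M) (I : Set ℝ) (hI : AnalyticCurves.IsOpenInterval I)
    (himm : AnalyticCurves.IsAnalyticImmersion E γ I)
    (hγ : AnalyticCurves.IsFreeCurve E G γ I) :
    ((AnalyticCurves.IsFreeSegment E G γ I ∨ AnalyticCurves.IsPositiveCurve E G γ I) ∧
      ¬ (AnalyticCurves.IsFreeSegment E G γ I ∧ AnalyticCurves.IsPositiveCurve E G γ I)) ∧
    ∀ t ∈ I, ∃ J : Set ℝ, AnalyticCurves.IsOpenInterval J ∧ t ∈ J ∧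
      AnalyticCurves.IsFreeInterval E G γ I J ∧
      ∀ g : G, g ≠ 1 → (((fun s => g • γ s) '' J) ∩ (γ '' J)).Finite := by
  have hfree' : ∀ (g : G) (x : M), g • x = x → g = 1 := fun g x hg => by
    have h1 : g ∈ MulAction.stabilizer G x := hg
    rwa [hfree x, Subgroup.mem_bot] at h1
  have : CompleteSpace E := FiniteDimensional.complete ℝ E
  have hO : ∀ h : G, AnalyticCurves.IsOpenAnalyticImmersion E (fun s => h • γ s) I :=
    (himm.isOpenAnalyticImmersion hI.1).smul hI.1 hM
  have H : AnalyticCurves.IsImmersedOn E G γ I :=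
    ⟨hI.1, hI.2.1.isPreconnected.ordConnected, fun h _ ht => (hO h).immersedAt hI.1 ht⟩
  -- An interior point of a free segment is the initial discrete point, from which discreteness
  -- spreads over `I`.
  obtain ⟨-, D, ⟨-, t₀, ht₀⟩, hDI, hD⟩ := hγ
  have ht₀I : t₀ ∈ I := hDI (interior_subset ht₀)
  have hdisc : ∀ q ∈ I, AnalyticCurves.IsDiscreteAt G γ I q := fun q hq =>
    AnalyticCurves.isDiscreteAt_of_mem H hfree' hsated ht₀I
      (AnalyticCurves.isDiscreteAt_of_isFreeSegment H hO hfree' ht₀I hD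
        (mem_interior_iff_mem_nhds.1 ht₀)) hq
  refine ⟨⟨?_, fun h =>
    AnalyticCurves.not_isFreeSegment_of_isPositiveCurve H hO hfree' h.2 h.1⟩, fun t ht =>
    (hdisc t ht).exists_isFreeInterval H hO hfree' ht⟩
  by_cases h : AnalyticCurves.IsFreeSegment E G γ I
  · exact Or.inl h
  · exact Or.inr
      (AnalyticCurves.isPositiveCurve_of_not_isFreeSegment H hO hI hfree' hdisc h)
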